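/- Let $n,m,k,l$ be non-negative integers with $m,k\le n$ and $m+k-n\le l\le \min(m,k)$ (call such $(n,m,k,l)$ admissible), and put $M=m-l$, $N=n-m-k+l$. Let the symmetric group $\mathfrak S_n$ act on $(\mathbb C^2)^{\otimes n}$, with orthonormal basis $|i_1\cdots i_n\rangle$ $(i_j\in\{0,1\})$, by permuting tensor factors. Let $|\Xi_{n,m|k,l}\rangle:=|1^l0^{k-l}\rangle\otimes|\Xi_{N+M,M}\rangle$, where $|\Xi_{N+M,M}\rangle:=\binom{N+M}{M}^{-1/2}\sum|j\rangle$, the sum running over all $j\in\{0,1\}^{N+M}$ with exactly $M$ entries equal to $1$. For $0\le x\le\lfloor n/2\rfloor$ let $\mathsf P_{(n-x,x)}$ be the orthogonal projector of $(\mathbb C^2)^{\otimes n}$ onto the isotypic component of the irreducible $\mathfrak S_n$-representation corresponding to the partition $(n-x,x)$. Let $P_{n,m,k,l}$ be the distribution on $\{0,\dots,\lfloor n/2\rfloor\}$ with probability mass function $p(x\mid n,m,k,l)=\langle\Xi_{n,m|k,l}|\mathsf P_{(n-x,x)}|\Xi_{n,m|k,l}\rangle$. For $0\le\xi\le1$ and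 $j\in\mathbb N$ let $B_{\xi,j}$ be the binomial distribution on $\{0,\dots,j\}$ with probability mass function $x\mapsto\binom jx\xi^x(1-\xi)^{j-x}$, and let $*$ denote convolution of probability distributions. **Theorem.** Fix integers $0\le l\le k$ and a real $\xi\in[0,1]$, and put $P_{R|\xi;k,l}:=B_{\xi,k-l}*B_{1-\xi,l}$. 1. There is a constant $C$, depending only on $k,l,\xi$, such that for all admissible $(n,m,k,l)$ with $n\ge1$ and $m=\xi n$, and all $A\subseteq\mathbb N$, $$\bigl|P_{n,m,k,l}(A)-P_{R|\xi;k,l}(A)\bigr|\le \frac Cn .$$ 2. $P_{R|\xi;k,l}$ is a probability distribution on $\{0,1,\dots,k\}$, with expectation $(k-l)\xi+l(1-\xi)$ and variance $k\xi(1-\xi)$. 3. If $X$ is distributed by $P_{n,m,k,l}$, then $\mathbb E[X]\to(k-l)\xi+l(1-\xi)$ as $n\to\infty$ along admissible $(n,m,k,l)$ with $m=\xi n$. -/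

import Mathlib

open MeasureTheory ProbabilityTheory Filter Topology

noncomputable section

namespace SchurWeyl

/-- The `n`-qubit space `(ℂ²)^{⊗ n}` with its standard Hermitian form, in coordinates with respect
to the orthonormal basis `|i₁ ⋯ iₙ⟩`, `(i₁, …, iₙ) ∈ {0,1}ⁿ`: a vector is the family of its
coordinates. -/
abbrev Qubits (n : ℕ) : Type := EuclideanSpace ℂ (Fin n → Fin 2)

/-- The action of the symmetric group on `(ℂ²)^{⊗ n}` by permutation of the tensor factors,
`π(g) |i₁ ⋯ iₙ⟩ = |i_{g⁻¹(1)} ⋯ i_{g⁻¹(n)}⟩`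
(see `permRep_single`); in coordinates, `(π(g) ψ)(j) = ψ(j ∘ g)`. -/
def permRep (n : ℕ) : Representation ℂ (Equiv.Perm (Fin n)) (Qubits n) where
  toFun g :=
    { toFun := fun ψ => WithLp.toLp 2 fun j => ψ (j ∘ g)
      map_add' := fun _ _ => rfl
      map_smul' := fun _ _ => rfl }
  map_one' := rfl
  map_mul' := fun _ _ => rfl

theorem permRep_apply (n : ℕ) (g : Equiv.Perm (Fin n)) (ψ : Qubits n) (j : Fin n → Fin 2) :
    permRep n g ψ j = ψ (j ∘ g) := rfl

theorem permRep_single (n : ℕ) (g : Equiv.Perm (Fin n)) (i : Fin n → Fin 2) :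
    permRep n g (EuclideanSpace.single i 1) =
      EuclideanSpace.single (i ∘ (g⁻¹ : Equiv.Perm (Fin n))) 1 := by
  ext j
  have h : j ∘ g = i ↔ j = i ∘ (g⁻¹ : Equiv.Perm (Fin n)) := by
    constructor
    · rintro rfl
      ext a
      simp
    · rintro rfl
      ext a
      simp
  rw [permRep_apply]
  simp only [PiLp.single_apply, h]

/-- The parameter range: `m, k ≤ n` and `m + k - n ≤ l ≤ min m k`. -/
structure Admissible (n m k l : ℕ) : Prop where
  m_le : m ≤ n
  k_le : k ≤ n
  add_le : m + k ≤ n + l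
  l_le_m : l ≤ m
  l_le_k : l ≤ k

/-- The vector `|Ξ_{n,m|k,l}⟩ = |1^l 0^{k-l}⟩ ⊗ |Ξ_{N+M,M}⟩`, where `M = m - l`,
`N = n - m - k + l` and `|Ξ_{N+M,M}⟩` is the Dicke state, the normalized sum
`binom(N+M, M)^{-1/2} ∑ |j⟩` over all `j ∈ {0,1}^{N+M}` with exactly `M` ones.
Note that `N + M = n - k`. -/
def Xi (n m k l : ℕ) : Qubits n :=
  WithLp.toLp 2 fun i =>
    if (∀ j : Fin n, (j : ℕ) < k → i j = if (j : ℕ) < l then 1 else 0) ∧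
        (Finset.univ.filter fun j : Fin n => k ≤ (j : ℕ) ∧ i j = 1).card = m - l then
      (((Real.sqrt ((n - k).choose (m - l)))⁻¹ : ℝ) : ℂ)
    else 0

/-- Row number of the entry `i` in the standard tableau of shape `(n - x, x)` whose first row is
`0, …, n-x-1` and whose second row is `n-x, …, n-1`. -/
def tableauRow (n x : ℕ) (i : Fin n) : ℕ := if (i : ℕ) < n - x then 0 else 1

/-- Column number of the entry `i` in the same tableau. -/
def tableauCol (n x : ℕ) (i : Fin n) : ℕ := if (i : ℕ) < n - x then i else i - (n - x)

/-- The permutations that preserve the labelling `f`. -/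
def labelStabilizer {n : ℕ} (f : Fin n → ℕ) : Finset (Equiv.Perm (Fin n)) :=
  Finset.univ.filter fun g => ∀ i, f (g i) = f i

/-- The Young symmetrizer of the partition `(n - x, x)` (where `2 * x ≤ n`): the row symmetrizer
times the column antisymmetrizer of the tableau above. -/
def youngSymmetrizer (n x : ℕ) : MonoidAlgebra ℂ (Equiv.Perm (Fin n)) :=
  (∑ g ∈ labelStabilizer (tableauRow n x), MonoidAlgebra.of ℂ _ g) *
    ∑ g ∈ labelStabilizer (tableauCol n x),
      ((Equiv.Perm.sign g : ℤ) : ℂ) • MonoidAlgebra.of ℂ _ g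

/-- The irreducible representation `𝒱_{(n-x,x)}` of the symmetric group that corresponds to the
partition `(n - x, x)` (the Specht module), as the left ideal of the group algebra generated by
the Young symmetrizer. -/
abbrev specht (n x : ℕ) : Submodule (MonoidAlgebra ℂ (Equiv.Perm (Fin n)))
    (MonoidAlgebra ℂ (Equiv.Perm (Fin n))) :=
  Submodule.span _ {youngSymmetrizer n x}

/-- The `𝒱_{(n-x,x)}`-isotypic component of `(ℂ²)^{⊗ n}`, that is, the summand
`𝒰_{(n-x,x)} ⊠ 𝒱_{(n-x,x)}` of the Schur-Weyl decomposition. -/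
def isotypic (n x : ℕ) : Submodule ℂ (Qubits n) :=
  ((isotypicComponent (MonoidAlgebra ℂ (Equiv.Perm (Fin n))) (permRep n).asModule
    (specht n x)).restrictScalars ℂ).map (permRep n).asModuleEquiv.toLinearMap

/-- The probability mass function `p(x | n,m,k,l) = ⟨Ξ| P_{(n-x,x)} |Ξ⟩`, where `P_{(n-x,x)}` is the
orthogonal projector onto the isotypic component. The number is real, as `P_{(n-x,x)}` is
self-adjoint. -/
def pmf (n m k l x : ℕ) : ℝ :=
  (inner ℂ (Xi n m k l) ((isotypic n x).starProjection (Xi n m k l))).re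

/-- The distribution `P_{n,m,k,l}` on `{0, …, ⌊n/2⌋}` with point masses `p(x | n,m,k,l)`,
as a measure on `ℕ`. -/
def law (n m k l : ℕ) : Measure ℕ :=
  ∑ x ∈ Finset.range (n / 2 + 1), ENNReal.ofReal (pmf n m k l x) • Measure.dirac x

/-- The convolution `B_{ξ,k-l} * B_{1-ξ,l}` of two binomial distributions. -/
def limitLaw (ξ : unitInterval) (k l : ℕ) : Measure ℕ :=
  (binomial (k - l) ξ).conv (binomial l (unitInterval.symm ξ))

end SchurWeyl

end

/-! The central element `∑_{i,j} (1 - (i j))` of the group algebra acts on the isotypic component of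
`(n - x, x)` by the scalar `2x(n + 1 - x)`. These scalars are distinct for `x ≤ n/2`, so the
distribution of `x` in a vector is a spectral measure of a single self-adjoint operator, `exchange`,
and its moments are matrix entries of powers of that operator (`inner_exchange_pow`). This also
needs the components of two-row shapes to span the whole space (`iSup_isotypic_eq_top`).

On vectors of weight `m = ξ n` whose coordinates depend only on the first `k` bits, `exchange` is
exactly `2n (A + B/n)`, with `A = resampling k ξ` and `B = resamplingCorrection k` acting on
functions of `k` bits and independent of `n` (`exchange_extend`). Hence the moments of `x(n + 1 -
x)/n` are entries of `(A + B/n)^r`, and these are within `O(1/n)` of the entries of `A^r`.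

`A` is a sum of commuting one-site operators with eigenvalues 0 and 1. At the bit string `1^l
0^{k-l}` its spectral measure is therefore a convolution of Bernoulli laws: a bit 1 contributes
eigenvalue 1 with probability `1 - ξ`, a bit 0 with probability `ξ`. This is `limitLaw`
(`resampling_pow_blockString`).

As the limit is carried by `{0, …, k}`, finitely many polynomial test functions turn the estimate on
moments into one in total variation with the same rate: Lagrange polynomials recover the point
masses and a nonnegative polynomial vanishing on `{0, …, k}` controls the tail. The expectation
needs a separate estimate by the second moment, since `x` ranges up to `n/2`. -/

noncomputable section

namespace SchurWeyl

open MonoidAlgebra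

/-! ### Young symmetrizers of two-row shapes and the central exchange element. -/

section YoungSymmetrizer

variable {n : ℕ}

theorem mem_labelStabilizer {f : Fin n → ℕ} {g : Equiv.Perm (Fin n)} :
    g ∈ labelStabilizer f ↔ ∀ i, f (g i) = f i := by
  simp [labelStabilizer]

theorem one_mem_labelStabilizer (f : Fin n → ℕ) : 1 ∈ labelStabilizer f := by
  simp [mem_labelStabilizer]

theorem mul_mem_labelStabilizer {f : Fin n → ℕ} {g h : Equiv.Perm (Fin n)}
    (hg : g ∈ labelStabilizer f) (hh : h ∈ labelStabilizer f) : g * h ∈ labelStabilizer f := by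
  rw [mem_labelStabilizer] at *
  intro i
  rw [Equiv.Perm.mul_apply, hg, hh]

theorem inv_mem_labelStabilizer {f : Fin n → ℕ} {g : Equiv.Perm (Fin n)}
    (hg : g ∈ labelStabilizer f) : g⁻¹ ∈ labelStabilizer f := by
  rw [mem_labelStabilizer] at *
  intro i
  rw [← hg (g⁻¹ i)]
  simp

theorem swap_mem_labelStabilizer {f : Fin n → ℕ} {i j : Fin n} (h : f i = f j) :
    Equiv.swap i j ∈ labelStabilizer f := by
  rw [mem_labelStabilizer]
  intro a
  rw [Equiv.swap_apply_def]
  split_ifs with h1 h2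
  · rw [h1, h]
  · rw [h2, h]
  · rfl

/-- The sum of the permutations that preserve the labelling `f`. -/
def labelSymmetrizer (f : Fin n → ℕ) : MonoidAlgebra ℂ (Equiv.Perm (Fin n)) :=
  ∑ g ∈ labelStabilizer f, of ℂ _ g

/-- The signed sum of the permutations that preserve the labelling `f`. -/
def labelAntisymmetrizer (f : Fin n → ℕ) : MonoidAlgebra ℂ (Equiv.Perm (Fin n)) :=
  ∑ g ∈ labelStabilizer f, ((Equiv.Perm.sign g : ℤ) : ℂ) • of ℂ _ g

theorem youngSymmetrizer_eq (n x : ℕ) : youngSymmetrizer n x =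
    labelSymmetrizer (tableauRow n x) * labelAntisymmetrizer (tableauCol n x) := rfl

theorem labelSymmetrizer_mul_of {f : Fin n → ℕ} {h : Equiv.Perm (Fin n)}
    (hh : h ∈ labelStabilizer f) : labelSymmetrizer f * of ℂ _ h = labelSymmetrizer f := by
  rw [labelSymmetrizer, Finset.sum_mul]
  refine Finset.sum_bij' (fun g _ => g * h) (fun g _ => g * h⁻¹)
    (fun g hg => mul_mem_labelStabilizer hg hh)
    (fun g hg => mul_mem_labelStabilizer hg (inv_mem_labelStabilizer hh)) ?_ ?_ ?_
  · intros; simp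
  · intros; simp
  · intros; rw [map_mul]

theorem of_mul_labelAntisymmetrizer {f : Fin n → ℕ} {h : Equiv.Perm (Fin n)}
    (hh : h ∈ labelStabilizer f) : of ℂ _ h * labelAntisymmetrizer f =
      ((Equiv.Perm.sign h : ℤ) : ℂ) • labelAntisymmetrizer f := by
  rw [labelAntisymmetrizer, Finset.mul_sum, Finset.smul_sum]
  refine Finset.sum_bij' (fun g _ => h * g) (fun g _ => h⁻¹ * g)
    (fun g hg => mul_mem_labelStabilizer hh hg)
    (fun g hg => mul_mem_labelStabilizer (inv_mem_labelStabilizer hh) hg) ?_ ?_ ?_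
  · intros; simp
  · intros; simp
  · intro g _
    rw [mul_smul_comm, ← map_mul, smul_smul, Equiv.Perm.sign_mul, Units.val_mul, Int.cast_mul,
      ← mul_assoc, ← Int.cast_mul, ← Units.val_mul, Int.units_mul_self, Units.val_one,
      Int.cast_one, one_mul]

theorem labelSymmetrizer_mul_of_mul_labelAntisymmetrizer_mul_swap {f f' : Fin n → ℕ}
    (g : Equiv.Perm (Fin n)) {i j : Fin n} (hij : i ≠ j) (h : f' i = f' j) :
    labelSymmetrizer f * of ℂ _ (g * Equiv.swap i j) * labelAntisymmetrizer f' =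
      -(labelSymmetrizer f * of ℂ _ g * labelAntisymmetrizer f') := by
  rw [map_mul, ← mul_assoc, mul_assoc (_ * _), of_mul_labelAntisymmetrizer
    (swap_mem_labelStabilizer h), Equiv.Perm.sign_swap hij]
  simp

/-- The swap of `i` and `j` changes the sign when absorbed on the right; moved across `g`, it is the
swap of `g i` and `g j` and is absorbed on the left without sign. So the product equals its own
negative. -/
theorem labelSymmetrizer_mul_of_mul_labelAntisymmetrizer_eq_zero {f f' : Fin n → ℕ}
    (g : Equiv.Perm (Fin n)) {i j : Fin n} (hij : i ≠ j) (h' : f' i = f' j)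
    (h : f (g i) = f (g j)) :
    labelSymmetrizer f * of ℂ _ g * labelAntisymmetrizer f' = 0 := by
  have h1 := labelSymmetrizer_mul_of_mul_labelAntisymmetrizer_mul_swap (f := f) g hij h'
  rw [Equiv.mul_swap_eq_swap_mul, map_mul, ← mul_assoc,
    labelSymmetrizer_mul_of (swap_mem_labelStabilizer h)] at h1
  rw [eq_neg_iff_add_eq_zero, ← two_smul ℂ] at h1
  exact (smul_eq_zero.mp h1).resolve_left two_ne_zero

theorem tableauRow_eq_zero {x : ℕ} {i : Fin n} : tableauRow n x i = 0 ↔ (i : ℕ) < n - x := by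
  unfold tableauRow; split_ifs <;> simp_all

theorem tableauRow_eq_one {x : ℕ} {i : Fin n} : tableauRow n x i = 1 ↔ ¬ (i : ℕ) < n - x := by
  unfold tableauRow; split_ifs <;> simp_all

/-- The entry in the first row above the entry `i` of the second row. -/
theorem exists_tableauCol_eq {x : ℕ} (hx : 2 * x ≤ n) {i : Fin n} (hi : ¬ (i : ℕ) < n - x) :
    ∃ j : Fin n, j ≠ i ∧ (j : ℕ) < n - x ∧ tableauCol n x j = tableauCol n x i := by
  refine ⟨⟨i - (n - x), by omega⟩, ?_, ?_, ?_⟩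
  · rw [Ne, Fin.ext_iff]; simp only; omega
  · simp only; omega
  · simp only [tableauCol]; split_ifs <;> omega

/-- Induction on the number of second-row entries that `g` sends to the first row. For such an `i`
with `j` above it, either `g j` is also in the first row and the product vanishes, or `g * swap j i`
has fewer such entries and the opposite product. If there are none, `g` preserves the rows. -/
theorem exists_labelSymmetrizer_mul_of_mul {x : ℕ} (hx : 2 * x ≤ n) (g : Equiv.Perm (Fin n)) :
    ∃ z : ℂ, labelSymmetrizer (tableauRow n x) * of ℂ _ g * labelAntisymmetrizer (tableauCol n x) =
      z • youngSymmetrizer n x := by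
  induction hN : (Finset.univ.filter fun i : Fin n =>
    ¬ (i : ℕ) < n - x ∧ ((g i : Fin n) : ℕ) < n - x).card using Nat.strong_induction_on generalizing g with
  | _ N ih =>
  by_cases hbad : ∃ i : Fin n, ¬ (i : ℕ) < n - x ∧ ((g i : Fin n) : ℕ) < n - x
  · obtain ⟨i, hi, hgi⟩ := hbad
    obtain ⟨j, hji, hj, hc⟩ := exists_tableauCol_eq hx hi
    by_cases hgj : ((g j : Fin n) : ℕ) < n - x
    · refine ⟨0, ?_⟩
      rw [zero_smul]
      refine labelSymmetrizer_mul_of_mul_labelAntisymmetrizer_eq_zero g hji hc ?_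
      rw [tableauRow_eq_zero.mpr hgi, tableauRow_eq_zero.mpr hgj]
    · have hlt : (Finset.univ.filter fun a : Fin n => ¬ (a : ℕ) < n - x ∧
          (((g * Equiv.swap j i) a : Fin n) : ℕ) < n - x).card < N := by
        rw [← hN]
        refine Finset.card_lt_card (Finset.ssubset_iff_of_subset ?_ |>.mpr ⟨i, ?_, ?_⟩)
        · intro a ha
          obtain ⟨h1, h2⟩ := (Finset.mem_filter.mp ha).2
          refine Finset.mem_filter.mpr ⟨Finset.mem_univ _, h1, ?_⟩
          rw [Equiv.Perm.mul_apply] at h2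
          have haj : a ≠ j := fun h => h1 (h ▸ hj)
          have hai : a ≠ i := fun h => by
            rw [h, Equiv.swap_apply_right] at h2
            exact hgj h2
          rwa [Equiv.swap_apply_of_ne_of_ne haj hai] at h2
        · simp only [Finset.mem_filter, Finset.mem_univ, true_and]
          exact ⟨hi, hgi⟩
        · simp [hgj]
      obtain ⟨z, hz⟩ := ih _ hlt _ rfl
      refine ⟨-z, ?_⟩
      rw [labelSymmetrizer_mul_of_mul_labelAntisymmetrizer_mul_swap g hji hc] at hz
      rw [neg_smul, ← hz, neg_neg]
  · push Not at hbad
    refine ⟨1, ?_⟩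
    have hS : (Finset.univ.filter fun i : Fin n => ¬ (i : ℕ) < n - x).map g.toEmbedding =
        Finset.univ.filter fun i : Fin n => ¬ (i : ℕ) < n - x := by
      refine Finset.eq_of_subset_of_card_le ?_ (by rw [Finset.card_map])
      intro a
      simp only [Finset.mem_map, Finset.mem_filter, Finset.mem_univ, true_and]
      rintro ⟨b, hb, rfl⟩
      exact not_lt.mpr (hbad b (not_lt.mp hb))
    rw [labelSymmetrizer_mul_of, one_smul, youngSymmetrizer_eq]
    rw [mem_labelStabilizer]
    intro i
    have h1 := congrArg (g i ∈ ·) hS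
    simp only [Finset.mem_map, Finset.mem_filter, Finset.mem_univ, true_and,
      Equiv.coe_toEmbedding, EmbeddingLike.apply_eq_iff_eq, exists_eq_right, eq_iff_iff] at h1
    unfold tableauRow
    split_ifs <;> tauto

theorem exists_labelSymmetrizer_mul_mul {x : ℕ} (hx : 2 * x ≤ n)
    (r : MonoidAlgebra ℂ (Equiv.Perm (Fin n))) :
    ∃ z : ℂ, labelSymmetrizer (tableauRow n x) * r * labelAntisymmetrizer (tableauCol n x) =
      z • youngSymmetrizer n x := by
  induction r using MonoidAlgebra.induction_on with
  | of g => exact exists_labelSymmetrizer_mul_of_mul hx g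
  | add f g hf hg =>
    obtain ⟨y, hy⟩ := hf
    obtain ⟨z, hz⟩ := hg
    exact ⟨y + z, by rw [mul_add, add_mul, hy, hz, add_smul]⟩
  | smul c f hf =>
    obtain ⟨y, hy⟩ := hf
    exact ⟨c * y, by rw [mul_smul_comm, smul_mul_assoc, hy, smul_smul]⟩

/-- With `c` the Young symmetrizer, `c r c` is always a multiple of `c`. A proper submodule `K` of
the ideal cannot contain `c`, so `c K = 0` and `K K = 0`; a left ideal with square zero that has a
complement (Maschke) is zero. -/
theorem isSimpleModule_specht {x : ℕ} (hx : 2 * x ≤ n) (hc : youngSymmetrizer n x ≠ 0) :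
    IsSimpleModule (MonoidAlgebra ℂ (Equiv.Perm (Fin n))) (specht n x) := by
  rw [isSimpleModule_iff_isAtom]
  refine ⟨by simpa [specht] using hc, fun K hK => ?_⟩
  have hcK : youngSymmetrizer n x ∉ K := fun h =>
    hK.not_ge ((Submodule.span_singleton_le_iff_mem _ _).mpr h)
  have hmem : ∀ u ∈ K, ∃ r, u = r * youngSymmetrizer n x := fun u hu => by
    obtain ⟨r, hr⟩ := Submodule.mem_span_singleton.mp (hK.le hu)
    exact ⟨r, hr.symm⟩
  have h0 : ∀ u ∈ K, youngSymmetrizer n x * u = 0 := fun u hu => by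
    obtain ⟨r, rfl⟩ := hmem u hu
    obtain ⟨z, hz⟩ := exists_labelSymmetrizer_mul_mul hx
      (labelAntisymmetrizer (tableauCol n x) * r * labelSymmetrizer (tableauRow n x))
    have h1 : youngSymmetrizer n x * (r * youngSymmetrizer n x) = z • youngSymmetrizer n x := by
      rw [← hz, youngSymmetrizer_eq]
      simp only [mul_assoc]
    have h2 := K.smul_mem (youngSymmetrizer n x) hu
    rw [smul_eq_mul, h1] at h2
    by_cases hz0 : z = 0
    · rw [h1, hz0, zero_smul]
    · refine absurd ?_ hcK
      have h3 := K.smul_of_tower_mem z⁻¹ h2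
      rwa [smul_smul, inv_mul_cancel₀ hz0, one_smul] at h3
  have hmul : ∀ u ∈ K, ∀ v ∈ K, u * v = 0 := fun u hu v hv => by
    obtain ⟨r, rfl⟩ := hmem u hu
    rw [mul_assoc, h0 v hv, mul_zero]
  obtain ⟨K', hK'⟩ := exists_isCompl K
  obtain ⟨e, he, e', he', hee⟩ := Submodule.mem_sup.mp
    (show (1 : MonoidAlgebra ℂ (Equiv.Perm (Fin n))) ∈ K ⊔ K' by rw [hK'.sup_eq_top]; trivial)
  rw [eq_bot_iff]
  intro u hu
  have h1 : u = u * e + u * e' := by rw [← mul_add, hee, mul_one]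
  rw [hmul u hu e he, zero_add] at h1
  have h2 : u ∈ K' := by rw [h1]; exact K'.smul_mem u he'
  exact (Submodule.disjoint_def.mp hK'.disjoint) u hu h2

/-- The central element `∑_{i,j} (1 - (i j))` of the group algebra. -/
def exchangeElement (n : ℕ) : MonoidAlgebra ℂ (Equiv.Perm (Fin n)) :=
  ∑ i : Fin n, ∑ j : Fin n, (1 - of ℂ _ (Equiv.swap i j))

theorem exchangeElement_mul_of (g : Equiv.Perm (Fin n)) :
    exchangeElement n * of ℂ _ g = of ℂ _ g * exchangeElement n := by
  simp only [exchangeElement, Finset.sum_mul, Finset.mul_sum, sub_mul, mul_sub, one_mul, mul_one,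
    ← map_mul]
  refine Fintype.sum_equiv g⁻¹ _ _ fun i => Fintype.sum_equiv g⁻¹ _ _ fun j => ?_
  rw [Equiv.mul_swap_eq_swap_mul]
  simp

theorem exchangeElement_comm (r : MonoidAlgebra ℂ (Equiv.Perm (Fin n))) :
    exchangeElement n * r = r * exchangeElement n := by
  induction r using MonoidAlgebra.induction_on with
  | of g => exact exchangeElement_mul_of g
  | add f g hf hg => rw [mul_add, add_mul, hf, hg]
  | smul c f hf => rw [mul_smul_comm, smul_mul_assoc, hf]

/-- A swap within a row is absorbed on the left, one within a column on the right with a sign.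
Otherwise it brings the second-row entry into the first row beside the entry of its own column, and
the product vanishes. -/
theorem labelSymmetrizer_mul_swap_mul {x : ℕ} (hx : 2 * x ≤ n) (i j : Fin n) :
    labelSymmetrizer (tableauRow n x) * of ℂ _ (Equiv.swap i j) *
        labelAntisymmetrizer (tableauCol n x) =
      (if tableauRow n x i = tableauRow n x j then (1 : ℂ) else
        if tableauCol n x i = tableauCol n x j then -1 else 0) • youngSymmetrizer n x := by
  have key : ∀ i j : Fin n, (i : ℕ) < n - x → ¬ (j : ℕ) < n - x →
      tableauCol n x i ≠ tableauCol n x j → 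
      labelSymmetrizer (tableauRow n x) * of ℂ _ (Equiv.swap i j) *
        labelAntisymmetrizer (tableauCol n x) = 0 := by
    intro i j hi hj hc
    obtain ⟨q, hqj, hq, hqc⟩ := exists_tableauCol_eq hx hj
    have hqi : q ≠ i := by rintro rfl; exact hc hqc
    refine labelSymmetrizer_mul_of_mul_labelAntisymmetrizer_eq_zero _ hqj hqc ?_
    rw [Equiv.swap_apply_right, Equiv.swap_apply_of_ne_of_ne hqi hqj,
      tableauRow_eq_zero.mpr hi, tableauRow_eq_zero.mpr hq]
  split_ifs with hr hc
  · rw [labelSymmetrizer_mul_of (swap_mem_labelStabilizer hr), one_smul, youngSymmetrizer_eq]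
  · have hij : i ≠ j := by rintro rfl; exact hr rfl
    rw [mul_assoc, of_mul_labelAntisymmetrizer (swap_mem_labelStabilizer hc),
      Equiv.Perm.sign_swap hij, youngSymmetrizer_eq]
    simp
  · rw [zero_smul]
    by_cases hi : (i : ℕ) < n - x
    · refine key i j hi (fun hj => hr ?_) hc
      rw [tableauRow_eq_zero.mpr hi, tableauRow_eq_zero.mpr hj]
    · rw [Equiv.swap_comm]
      refine key j i ?_ hi (Ne.symm hc)
      by_contra hj
      refine hr ?_
      rw [tableauRow_eq_one.mpr hi, tableauRow_eq_one.mpr hj]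

/-- Each of the `2x(n - x)` ordered pairs in different rows contributes 1, and the `2x` of them that
share a column contribute 1 more. -/
theorem sum_sum_content {x : ℕ} (hx : 2 * x ≤ n) :
    ∑ i : Fin n, ∑ j : Fin n, (1 - if tableauRow n x i = tableauRow n x j then (1 : ℂ) else
        if tableauCol n x i = tableauCol n x j then -1 else 0) = 2 * x * (n + 1 - x) := by
  obtain ⟨y, rfl⟩ : ∃ y, n = (x + y) + x := ⟨n - 2 * x, by omega⟩
  have e : x + y + x - x = x + y := by omega
  simp only [Fin.sum_univ_add, tableauRow, tableauCol, Fin.val_castAdd, Fin.val_natAdd, e]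
  have l1 : ∀ i : Fin x, (i : ℕ) < x + y := fun i => by omega
  have l2 : ∀ i : Fin y, x + (i : ℕ) < x + y := fun i => by omega
  have l3 : ∀ (i : Fin x) (j : Fin y), x + (j : ℕ) ≠ i := fun i j => by omega
  have l4 : ∀ (i : Fin x) (j : Fin y), (i : ℕ) ≠ x + j := fun i j => by omega
  simp only [l1, l2, if_true, Nat.not_lt.mpr (Nat.le_add_right _ _), if_false,
    Nat.add_sub_cancel_left, l3, l4, zero_ne_one, one_ne_zero, Fin.val_inj]
  simp [Finset.sum_sub_distrib, Finset.sum_ite_eq]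
  ring

theorem exchangeElement_mul_youngSymmetrizer {x : ℕ} (hx : 2 * x ≤ n) :
    exchangeElement n * youngSymmetrizer n x =
      (2 * x * (n + 1 - x) : ℂ) • youngSymmetrizer n x := by
  rw [youngSymmetrizer_eq, ← mul_assoc, exchangeElement_comm, ← sum_sum_content hx,
    Finset.sum_smul]
  simp only [exchangeElement, Finset.sum_mul, Finset.mul_sum, Finset.sum_smul, mul_sub, sub_mul,
    labelSymmetrizer_mul_swap_mul hx, sub_smul, one_smul, mul_one, youngSymmetrizer_eq]

theorem exchangeElement_mul_of_mem_specht {x : ℕ} (hx : 2 * x ≤ n)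
    {u : MonoidAlgebra ℂ (Equiv.Perm (Fin n))} (hu : u ∈ specht n x) :
    exchangeElement n * u = (2 * x * (n + 1 - x) : ℂ) • u := by
  obtain ⟨r, rfl⟩ := Submodule.mem_span_singleton.mp hu
  rw [smul_eq_mul, ← mul_assoc, exchangeElement_comm, mul_assoc,
    exchangeElement_mul_youngSymmetrizer hx, mul_smul_comm]

end YoungSymmetrizer

/-! ### Vectors that a Young symmetrizer does not annihilate. -/

section Antisymmetry

variable {n : ℕ}

theorem permRep_mul_apply (g h : Equiv.Perm (Fin n)) (w : Qubits n) :
    permRep n (g * h) w = permRep n g (permRep n h w) := rfl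

theorem permRep_inv_self_apply (g : Equiv.Perm (Fin n)) (w : Qubits n) :
    permRep n g⁻¹ (permRep n g w) = w := by
  rw [← permRep_mul_apply, inv_mul_cancel, map_one, Module.End.one_apply]

theorem permRep_injective (g : Equiv.Perm (Fin n)) : Function.Injective (permRep n g) :=
  Function.LeftInverse.injective (permRep_inv_self_apply g)

/-- The involution that exchanges the two entries of each column of length two. -/
def columnInvolution {x : ℕ} (hx : 2 * x ≤ n) : Equiv.Perm (Fin n) :=
  Function.Involutive.toPerm
    (fun i => ⟨if (i : ℕ) < n - x then (if (i : ℕ) < x then i + (n - x) else i)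
      else i - (n - x), by split_ifs <;> omega⟩) (by
    intro i
    apply Fin.ext
    simp only
    split_ifs <;> omega)

theorem columnInvolution_apply_val {x : ℕ} (hx : 2 * x ≤ n) (i : Fin n) :
    (columnInvolution hx i : ℕ) = if (i : ℕ) < n - x then
      (if (i : ℕ) < x then i + (n - x) else i) else i - (n - x) := rfl

theorem columnInvolution_sq {x : ℕ} (hx : 2 * x ≤ n) : columnInvolution hx ^ 2 = 1 := by
  ext i
  rw [sq, Equiv.Perm.mul_apply, columnInvolution_apply_val, columnInvolution_apply_val,
    Equiv.Perm.one_apply]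
  split_ifs <;> omega

theorem columnInvolution_ne_iff {x : ℕ} (hx : 2 * x ≤ n) (i : Fin n) :
    columnInvolution hx i ≠ i ↔ (i : ℕ) < x ∨ n - x ≤ i := by
  have := i.isLt
  rw [Ne, Fin.ext_iff, columnInvolution_apply_val]
  split_ifs <;> omega

theorem columnInvolution_eq_of_tableauCol_eq {x : ℕ} (hx : 2 * x ≤ n) {i j : Fin n} (hij : i ≠ j)
    (h : tableauCol n x i = tableauCol n x j) : columnInvolution hx i = j := by
  have := i.isLt
  have := j.isLt
  rw [Ne, Fin.ext_iff] at hij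
  rw [Fin.ext_iff, columnInvolution_apply_val]
  unfold tableauCol at h
  split_ifs at * <;> omega

theorem card_support_columnInvolution {x : ℕ} (hx : 2 * x ≤ n) :
    (columnInvolution hx).support.card = 2 * x := by
  obtain ⟨y, rfl⟩ : ∃ y, n = (x + y) + x := ⟨n - 2 * x, by omega⟩
  have : (columnInvolution hx).support =
      Finset.univ.filter fun i : Fin ((x + y) + x) => (i : ℕ) < x ∨ x + y + x - x ≤ i := by
    ext i
    rw [Equiv.Perm.mem_support, columnInvolution_ne_iff]
    simp
  rw [this, Finset.card_filter]
  have e : x + y + x - x = x + y := by omega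
  simp only [Fin.sum_univ_add, Fin.val_castAdd, Fin.val_natAdd, e]
  have l1 : ∀ i : Fin y, (x + (i : ℕ) < x ∨ x + y ≤ x + (i : ℕ)) = False := fun i => by
    simp
  have l2 : ∀ i : Fin x, ((i : ℕ) < x ∨ x + y ≤ (i : ℕ)) = True := fun i => by simp
  have l3 : ∀ i : Fin x, (x + y + (i : ℕ) < x ∨ x + y ≤ x + y + (i : ℕ)) = True := fun i => by simp
  simp only [l1, l2, l3, if_true, if_false]
  simp
  omega

theorem isConj_columnInvolution {σ : Equiv.Perm (Fin n)} (hσ : σ ^ 2 = 1) :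
    ∃ (x : ℕ) (hx : 2 * x ≤ n), IsConj σ (columnInvolution hx) := by
  have : Fact (Nat.Prime 2) := ⟨Nat.prime_two⟩
  have h1 := Equiv.Perm.cycleType_of_pow_prime_eq_one hσ
  have h2 := Equiv.Perm.sum_cycleType σ
  rw [h1, Multiset.sum_replicate, smul_eq_mul] at h2
  have hx : 2 * σ.cycleType.card ≤ n := by
    have := Finset.card_le_univ σ.support
    rw [Fintype.card_fin] at this
    omega
  refine ⟨σ.cycleType.card, hx, Equiv.Perm.isConj_of_cycleType_eq ?_⟩
  have h3 := Equiv.Perm.cycleType_of_pow_prime_eq_one (columnInvolution_sq hx)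
  have h4 := Equiv.Perm.sum_cycleType (columnInvolution hx)
  rw [h3, Multiset.sum_replicate, smul_eq_mul, card_support_columnInvolution] at h4
  have h5 : (columnInvolution hx).cycleType.card = σ.cycleType.card := by omega
  rw [h3, h5, ← h1]

/-- A nonzero invariant subspace contains a nonzero vector that is antisymmetric in the columns of
some two-row tableau and symmetric in the remaining entries. -/
theorem exists_antisymmetric_of_ne_bot {V : Submodule ℂ (Qubits n)} (hV : V ≠ ⊥)
    (hinv : ∀ g, ∀ w ∈ V, permRep n g w ∈ V) :
    ∃ x, 2 * x ≤ n ∧ ∃ w ∈ V, w ≠ 0 ∧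
      (∀ i j, i ≠ j → tableauCol n x i = tableauCol n x j →
        permRep n (Equiv.swap i j) w = -w) ∧
      ∀ i j : Fin n, x ≤ (i : ℕ) → (i : ℕ) < n - x → x ≤ (j : ℕ) → (j : ℕ) < n - x →
        permRep n (Equiv.swap i j) w = w := by
  classical
  obtain ⟨v, hv, hv0⟩ := Submodule.exists_mem_ne_zero_of_ne_bot hV
  -- Among the involutions whose 2-cycles all act by `-1` on some nonzero vector of `V`, take one of
  -- largest support; the identity qualifies.
  obtain ⟨σ, hσmem, hmax⟩ := Finset.exists_max_image
    (Finset.univ.filter fun σ : Equiv.Perm (Fin n) => σ ^ 2 = 1 ∧ ∃ w ∈ V, w ≠ 0 ∧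
      ∀ i, σ i ≠ i → permRep n (Equiv.swap i (σ i)) w = -w) (fun σ => σ.support.card)
    ⟨1, by simpa using ⟨v, hv, hv0⟩⟩
  obtain ⟨hσ, w, hw, hw0, hanti⟩ := (Finset.mem_filter.mp hσmem).2
  have hσσ : ∀ i, σ (σ i) = i := fun i => by
    rw [← Equiv.Perm.mul_apply, ← sq, hσ, Equiv.Perm.one_apply]
  have hsym : ∀ p q, σ p = p → σ q = q → permRep n (Equiv.swap p q) w = w := by
    intro p q hp hq
    by_cases hpq : p = q
    · rw [hpq, Equiv.swap_self]
      exact congrArg (· w) (map_one (permRep n))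
    by_contra hne
    have hsw : permRep n (Equiv.swap p q) (permRep n (Equiv.swap p q) w) = w := by
      rw [← permRep_mul_apply, Equiv.swap_mul_self, map_one, Module.End.one_apply]
    have hdis : ∀ i, i ≠ p → i ≠ q → σ i ≠ p ∧ σ i ≠ q := fun i hip hiq =>
      ⟨fun h => hip (by rw [← hσσ i, h, hp]), fun h => hiq (by rw [← hσσ i, h, hq])⟩
    have happ : ∀ i, i ≠ p → i ≠ q → (σ * Equiv.swap p q) i = σ i := fun i hip hiq => by
      rw [Equiv.Perm.mul_apply, Equiv.swap_apply_of_ne_of_ne hip hiq]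
    have happ1 : (σ * Equiv.swap p q) p = q := by simp [hq]
    have happ2 : (σ * Equiv.swap p q) q = p := by simp [hp]
    -- If `w` were not symmetric in the fixed points `p`, `q`, then `w - (p q) w` would be nonzero
    -- and antisymmetric for the larger involution `σ (p q)`.
    refine absurd (hmax (σ * Equiv.swap p q) ?_) (not_le.mpr ?_)
    · refine Finset.mem_filter.mpr ⟨Finset.mem_univ _, ?_,
        w - permRep n (Equiv.swap p q) w, V.sub_mem hw (hinv _ _ hw),
        sub_ne_zero.mpr (Ne.symm hne), ?_⟩
      · ext i
        rw [sq, Equiv.Perm.mul_apply, Equiv.Perm.one_apply]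
        by_cases hip : i = p
        · rw [hip, happ1, happ2]
        by_cases hiq : i = q
        · rw [hiq, happ2, happ1]
        rw [happ i hip hiq, happ _ (hdis i hip hiq).1 (hdis i hip hiq).2, hσσ]
      · intro i hi
        by_cases hip : i = p
        · rw [hip, happ1, map_sub, hsw, neg_sub]
        by_cases hiq : i = q
        · rw [hiq, happ2, Equiv.swap_comm, map_sub, hsw, neg_sub]
        rw [happ i hip hiq] at hi ⊢
        have hcomm : Equiv.swap i (σ i) * Equiv.swap p q = Equiv.swap p q * Equiv.swap i (σ i) := by
          rw [Equiv.mul_swap_eq_swap_mul (Equiv.swap p q),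
            Equiv.swap_apply_of_ne_of_ne hip hiq,
            Equiv.swap_apply_of_ne_of_ne (hdis i hip hiq).1 (hdis i hip hiq).2]
        rw [map_sub, ← permRep_mul_apply, hcomm, permRep_mul_apply, hanti i hi, map_neg]
        abel
    · refine Finset.card_lt_card (Finset.ssubset_iff_of_subset ?_ |>.mpr ⟨p, ?_, ?_⟩)
      · intro i hi
        rw [Equiv.Perm.mem_support] at hi ⊢
        have hip : i ≠ p := fun h => hi (h ▸ hp)
        have hiq : i ≠ q := fun h => hi (h ▸ hq)
        rwa [happ i hip hiq]
      · rw [Equiv.Perm.mem_support, happ1]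
        exact Ne.symm hpq
      · rw [Equiv.Perm.mem_support, not_not, hp]
  obtain ⟨x, hx, hconj⟩ := isConj_columnInvolution hσ
  obtain ⟨g, hg⟩ := isConj_iff.mp hconj
  have hgσ : ∀ i, columnInvolution hx (g i) = g (σ i) := fun i => by
    rw [← hg]; simp
  have htr : ∀ i j, permRep n (Equiv.swap (g i) (g j)) (permRep n g w) =
      permRep n g (permRep n (Equiv.swap i j) w) := fun i j => by
    rw [← permRep_mul_apply, ← permRep_mul_apply, Equiv.mul_swap_eq_swap_mul g]
  refine ⟨x, hx, permRep n g w, hinv g w hw, fun h => hw0 ?_, ?_, ?_⟩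
  · rw [← map_zero (permRep n g)] at h
    exact permRep_injective g h
  · intro i j hij hc
    have hτ := columnInvolution_eq_of_tableauCol_eq hx hij hc
    obtain ⟨i, rfl⟩ := g.surjective i
    obtain ⟨j, rfl⟩ := g.surjective j
    rw [hgσ, EmbeddingLike.apply_eq_iff_eq] at hτ
    subst hτ
    rw [htr, hanti i (fun h => hij (by rw [h])), map_neg]
  · intro i j hi hi' hj hj'
    have h1 := (columnInvolution_ne_iff hx i).not.mpr (by omega)
    have h2 := (columnInvolution_ne_iff hx j).not.mpr (by omega)
    obtain ⟨i, rfl⟩ := g.surjective i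
    obtain ⟨j, rfl⟩ := g.surjective j
    rw [not_not, hgσ, EmbeddingLike.apply_eq_iff_eq] at h1 h2
    rw [htr, hsym i j h1 h2]

theorem permRep_eq_sign_smul_of_swap {f : Fin n → ℕ} {w : Qubits n}
    (hw : ∀ i j, i ≠ j → f i = f j → permRep n (Equiv.swap i j) w = -w)
    {h : Equiv.Perm (Fin n)} (hh : h ∈ labelStabilizer f) :
    permRep n h w = ((Equiv.Perm.sign h : ℤ) : ℂ) • w := by
  induction hN : h.support.card using Nat.strong_induction_on generalizing h with
  | _ N ih =>
  by_cases h1 : ∀ i, h i = i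
  · have : h = 1 := Equiv.ext h1
    subst this
    simp
  push Not at h1
  obtain ⟨i, hi⟩ := h1
  have hf : f i = f (h i) := (mem_labelStabilizer.mp hh i).symm
  have h2 := ih _ (hN ▸ Equiv.Perm.card_support_swap_mul hi)
    (mul_mem_labelStabilizer (swap_mem_labelStabilizer hf) hh) rfl
  have h3 : h = Equiv.swap i (h i) * (Equiv.swap i (h i) * h) := by
    rw [Equiv.swap_mul_self_mul]
  have h4 : permRep n h w = permRep n (Equiv.swap i (h i))
      (permRep n (Equiv.swap i (h i) * h) w) := by
    rw [← permRep_mul_apply, ← h3]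
  rw [h4, h2, map_smul, hw i _ (Ne.symm hi) hf, Equiv.Perm.sign_mul,
    Equiv.Perm.sign_swap (Ne.symm hi)]
  simp

/-- The two strings differ by a permutation of the middle positions. A swap of a surplus one with a
missing one reduces the number of disagreements. -/
theorem apply_eq_of_card_eq {x : ℕ} {w : Qubits n}
    (hsym : ∀ i j : Fin n, x ≤ (i : ℕ) → (i : ℕ) < n - x → x ≤ (j : ℕ) → (j : ℕ) < n - x →
        permRep n (Equiv.swap i j) w = w)
    {j j' : Fin n → Fin 2} (hout : ∀ i : Fin n, j i ≠ j' i → x ≤ (i : ℕ) ∧ (i : ℕ) < n - x)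
    (hcard : (Finset.univ.filter fun i => j i = 1).card =
      (Finset.univ.filter fun i => j' i = 1).card) : w j = w j' := by
  induction hN : (Finset.univ.filter fun i => j i ≠ j' i).card using Nat.strong_induction_on
    generalizing j with
  | _ N ih =>
  by_cases hS : (Finset.univ.filter fun i => j i = 1) = Finset.univ.filter fun i => j' i = 1
  · refine congrArg w (funext fun i => ?_)
    have := congrArg (i ∈ ·) hS
    simp only [Finset.mem_filter, Finset.mem_univ, true_and, eq_iff_iff] at this
    omega
  obtain ⟨p, hp, hp'⟩ := Finset.not_subset.mp fun h => hS (Finset.eq_of_subset_of_card_le h hcard.ge)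
  obtain ⟨q, hq', hq⟩ := Finset.not_subset.mp fun h =>
    hS (Finset.eq_of_subset_of_card_le h hcard.le).symm
  simp only [Finset.mem_filter, Finset.mem_univ, true_and] at hp hp' hq hq'
  have hpq : p ≠ q := fun h => hp' (h ▸ hq')
  have h1 := hout p (by rw [hp]; exact Ne.symm hp')
  have h2 := hout q (by rw [hq']; exact hq)
  have h3 : w (j ∘ Equiv.swap p q) = w j := by
    rw [← permRep_apply, hsym p q h1.1 h1.2 h2.1 h2.2]
  have e1 : (j ∘ Equiv.swap p q) p = j' p := by
    rw [Function.comp_apply, Equiv.swap_apply_left]; omega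
  have e2 : (j ∘ Equiv.swap p q) q = j' q := by
    rw [Function.comp_apply, Equiv.swap_apply_right]; omega
  have e3 : ∀ i, i ≠ p → i ≠ q → (j ∘ Equiv.swap p q) i = j i := fun i hip hiq => by
    rw [Function.comp_apply, Equiv.swap_apply_of_ne_of_ne hip hiq]
  rw [← h3]
  have hsub : (Finset.univ.filter fun i => (j ∘ Equiv.swap p q) i ≠ j' i) ⊂
      Finset.univ.filter fun i => j i ≠ j' i := by
    refine Finset.ssubset_iff_of_subset ?_ |>.mpr ⟨p, ?_, ?_⟩
    · intro i hi
      have hi := (Finset.mem_filter.mp hi).2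
      refine Finset.mem_filter.mpr ⟨Finset.mem_univ _, ?_⟩
      rwa [e3 i (fun h => hi (h ▸ e1)) (fun h => hi (h ▸ e2))] at hi
    · refine Finset.mem_filter.mpr ⟨Finset.mem_univ _, ?_⟩
      rw [hp]; exact Ne.symm hp'
    · exact fun h => (Finset.mem_filter.mp h).2 e1
  refine ih _ (hN ▸ Finset.card_lt_card hsub) ?_ ?_ rfl
  · intro i hi
    exact hout i (Finset.mem_filter.mp (hsub.subset (Finset.mem_filter.mpr
      ⟨Finset.mem_univ _, hi⟩))).2
  · rw [← hcard]
    refine Finset.card_bij' (fun i _ => Equiv.swap p q i) (fun i _ => Equiv.swap p q i) ?_ ?_ ?_ ?_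
      <;> simp

theorem youngSymmetrizer_apply_ne_zero {x : ℕ} (hx : 2 * x ≤ n) {w : Qubits n} (hw : w ≠ 0)
    (hanti : ∀ i j, i ≠ j → tableauCol n x i = tableauCol n x j →
        permRep n (Equiv.swap i j) w = -w)
    (hsym : ∀ i j : Fin n, x ≤ (i : ℕ) → (i : ℕ) < n - x → x ≤ (j : ℕ) → (j : ℕ) < n - x →
        permRep n (Equiv.swap i j) w = w) :
    (permRep n).asAlgebraHom (youngSymmetrizer n x) w ≠ 0 := by
  classical
  have hb : (permRep n).asAlgebraHom (labelAntisymmetrizer (tableauCol n x)) w =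
      ((labelStabilizer (tableauCol n x)).card : ℂ) • w := by
    rw [labelAntisymmetrizer, map_sum, LinearMap.sum_apply, Finset.sum_congr rfl (g := fun _ => w)]
    · rw [Finset.sum_const, Nat.cast_smul_eq_nsmul]
    · intro g hg
      rw [map_smul, LinearMap.smul_apply, Representation.asAlgebraHom_of,
        permRep_eq_sign_smul_of_swap hanti hg, smul_smul, ← Int.cast_mul, ← Units.val_mul,
        Int.units_mul_self]
      simp
  rw [youngSymmetrizer_eq, map_mul, Module.End.mul_apply, hb, map_smul]
  refine smul_ne_zero (Nat.cast_ne_zero.mpr (Finset.card_ne_zero_of_mem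
    (one_mem_labelStabilizer _))) ?_
  -- Antisymmetry kills every coordinate with two equal bits in a column.
  have hdiff : ∀ j, w j ≠ 0 → ∀ i i', i ≠ i' → tableauCol n x i = tableauCol n x i' →
      j i ≠ j i' := by
    intro j hj i i' hii hc hjj
    have h1 : j ∘ Equiv.swap i i' = j := by
      ext a
      rw [Function.comp_apply, Equiv.swap_apply_def]
      split_ifs with h1 h2
      · rw [h1, hjj]
      · rw [h2, hjj]
      · rfl
    have h2 := permRep_apply n (Equiv.swap i i') w j
    rw [h1, hanti i i' hii hc, PiLp.neg_apply, neg_eq_iff_add_eq_zero, ← two_mul] at h2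
    exact hj ((mul_eq_zero.mp h2).resolve_left two_ne_zero)
  obtain ⟨j₀, hj₀⟩ : ∃ j, w j ≠ 0 := by
    by_contra h
    push Not at h
    exact hw (PiLp.ext h)
  -- Column swaps only change the sign of a coordinate, so a string in the support of `w` with most
  -- ones in the second row has only ones there.
  obtain ⟨j, hjmem, hmax⟩ := Finset.exists_max_image (Finset.univ.filter fun j => w j ≠ 0)
    (fun j => (Finset.univ.filter fun i : Fin n => ¬ (i : ℕ) < n - x ∧ j i = 1).card)
    ⟨j₀, by simpa using hj₀⟩
  have hj : w j ≠ 0 := (Finset.mem_filter.mp hjmem).2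
  have hrow : ∀ i : Fin n, ¬ (i : ℕ) < n - x → j i = 1 := by
    intro i hi
    by_contra hji
    obtain ⟨q, hqi, hq, hqc⟩ := exists_tableauCol_eq hx hi
    have hjq := hdiff j hj q i hqi hqc
    refine absurd (hmax (j ∘ Equiv.swap q i) ?_) (not_le.mpr (Finset.card_lt_card
      (Finset.ssubset_iff_of_subset ?_ |>.mpr ⟨i, ?_, ?_⟩)))
    · refine Finset.mem_filter.mpr ⟨Finset.mem_univ _, ?_⟩
      rw [← permRep_apply, hanti q i hqi hqc, PiLp.neg_apply]
      exact neg_ne_zero.mpr hj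
    · intro a ha
      obtain ⟨ha1, ha2⟩ := (Finset.mem_filter.mp ha).2
      refine Finset.mem_filter.mpr ⟨Finset.mem_univ _, ha1, ?_⟩
      rw [Function.comp_apply, Equiv.swap_apply_of_ne_of_ne (fun h => ha1 (by rw [h]; exact hq))
        (fun h => hji (by rw [← h]; exact ha2)), ha2]
    · refine Finset.mem_filter.mpr ⟨Finset.mem_univ _, hi, ?_⟩
      rw [Function.comp_apply, Equiv.swap_apply_right]
      omega
    · exact fun h => hji (Finset.mem_filter.mp h).2.2
  have hfirst : ∀ j, w j ≠ 0 → (∀ i : Fin n, ¬ (i : ℕ) < n - x → j i = 1) →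
      ∀ i : Fin n, (i : ℕ) < x → j i = 0 := by
    intro j hj hrow i hi
    have h1 := hdiff j hj i ⟨i + (n - x), by omega⟩
      (by rw [Ne, Fin.ext_iff]; simp only; omega)
      (by simp only [tableauCol]; split_ifs <;> omega)
    rw [hrow ⟨i + (n - x), by omega⟩ (by simp)] at h1
    omega
  -- No cancellation occurs in the row symmetrization at `j`: every term is 0 or `w j`, and the
  -- identity contributes `w j`.
  have hterm : ∀ g ∈ labelStabilizer (tableauRow n x), w (j ∘ g) = 0 ∨ w (j ∘ g) = w j := by
    intro g hg
    rw [or_iff_not_imp_left]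
    intro hne
    have hrow' : ∀ i : Fin n, ¬ (i : ℕ) < n - x → (j ∘ g) i = 1 := fun i hi => by
      refine hrow _ ?_
      rw [← tableauRow_eq_one, mem_labelStabilizer.mp hg i]
      exact tableauRow_eq_one.mpr hi
    refine apply_eq_of_card_eq hsym ?_ ?_
    · intro i hi
      constructor
      · by_contra h
        exact hi (by rw [hfirst j hj hrow i (by omega), hfirst _ hne hrow' i (by omega)])
      · by_contra h
        exact hi (by rw [hrow i h, hrow' i h])
    · exact Finset.card_bij' (fun i _ => g i) (fun i _ => g⁻¹ i) (by simp) (by simp) (by simp)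
        (by simp)
  intro h0
  have h1 : ∑ g ∈ labelStabilizer (tableauRow n x), w (j ∘ g) = 0 := by
    have := congrArg (fun v : Qubits n => v j) h0
    simpa [labelSymmetrizer, LinearMap.sum_apply, permRep_apply, WithLp.ofLp_sum] using this
  have h2 : ∑ g ∈ labelStabilizer (tableauRow n x), w (j ∘ g) =
      ((labelStabilizer (tableauRow n x)).filter fun g : Equiv.Perm (Fin n) => w (j ∘ g) ≠ 0).card * w j := by
    rw [← nsmul_eq_mul, ← Finset.sum_const, Finset.sum_filter]
    refine Finset.sum_congr rfl fun g hg => ?_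
    rcases hterm g hg with h | h
    · simp [h]
    · rw [if_pos (by rw [h]; exact hj), h]
  rw [h2] at h1
  refine (mul_ne_zero (Nat.cast_ne_zero.mpr (Finset.card_ne_zero_of_mem (a := 1) ?_)) hj) h1
  exact Finset.mem_filter.mpr ⟨one_mem_labelStabilizer _, hj⟩

end Antisymmetry

/-! ### The isotypic components as orthogonal eigenspaces that span. -/

section Isotypic

variable {n : ℕ}

/-- The operator `∑_{i,j} (1 - π((i j)))`. -/
def exchange (n : ℕ) : Qubits n →ₗ[ℂ] Qubits n :=
  ∑ i : Fin n, ∑ j : Fin n, (1 - permRep n (Equiv.swap i j))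

theorem asAlgebraHom_exchangeElement :
    (permRep n).asAlgebraHom (exchangeElement n) = exchange n := by
  simp only [exchangeElement, exchange, map_sum, map_sub, map_one, Representation.asAlgebraHom_of]

theorem exchange_apply (ψ : Qubits n) (j : Fin n → Fin 2) :
    exchange n ψ j = ∑ a : Fin n, ∑ b : Fin n, (ψ j - ψ (j ∘ Equiv.swap a b)) := by
  simp [exchange, LinearMap.sum_apply, permRep_apply, WithLp.ofLp_sum]

theorem inner_permRep (g : Equiv.Perm (Fin n)) (φ ψ : Qubits n) :
    inner ℂ (permRep n g φ) ψ = inner ℂ φ (permRep n g⁻¹ ψ) := by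
  simp only [PiLp.inner_apply, permRep_apply]
  refine Fintype.sum_equiv (Equiv.arrowCongr g.symm (Equiv.refl _)) _ _ fun j => ?_
  have h : ((Equiv.arrowCongr g.symm (Equiv.refl (Fin 2))) j) ∘ (g⁻¹ : Equiv.Perm (Fin n)) = j := by
    ext a
    simp
  rw [h]
  rfl

theorem exchange_isSymmetric : (exchange n).IsSymmetric := by
  intro φ ψ
  simp only [exchange, LinearMap.sum_apply, sum_inner, inner_sum, LinearMap.sub_apply,
    inner_sub_left, inner_sub_right, inner_permRep, Equiv.swap_inv, Module.End.one_apply]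

theorem mem_isotypic {x : ℕ} {v : Qubits n} : v ∈ isotypic n x ↔
    (permRep n).asModuleEquiv.symm v ∈ isotypicComponent (MonoidAlgebra ℂ (Equiv.Perm (Fin n)))
      (permRep n).asModule (specht n x) := by
  rw [isotypic, Submodule.mem_map]
  constructor
  · rintro ⟨u, hu, rfl⟩
    simpa using hu
  · intro h
    exact ⟨_, h, by simp⟩

theorem exchange_apply_of_mem_isotypic {x : ℕ} (hx : 2 * x ≤ n) {v : Qubits n}
    (hv : v ∈ isotypic n x) : exchange n v = (2 * x * (n + 1 - x) : ℂ) • v := by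
  -- By centrality the eigenspace is a submodule over the group algebra, so it suffices that it
  -- contains each copy of the Specht module.
  let E : Submodule (MonoidAlgebra ℂ (Equiv.Perm (Fin n))) (permRep n).asModule :=
    { carrier := {u | exchangeElement n • u = (2 * x * (n + 1 - x) : ℂ) • u}
      add_mem' := fun {a b} ha hb => by
        simp only [Set.mem_ofPred_eq] at *
        rw [smul_add, smul_add, ha, hb]
      zero_mem' := by simp
      smul_mem' := fun r a ha => by
        simp only [Set.mem_ofPred_eq] at *
        rw [smul_smul, exchangeElement_comm, ← smul_smul, ha, smul_comm] }
  have hle : isotypicComponent (MonoidAlgebra ℂ (Equiv.Perm (Fin n)))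
      (permRep n).asModule (specht n x) ≤ E := by
    refine sSup_le ?_
    rintro m ⟨e⟩ u hu
    have h1 : exchangeElement n • (⟨u, hu⟩ : m) = (2 * x * (n + 1 - x) : ℂ) • ⟨u, hu⟩ := by
      apply e.injective
      have h2 := exchangeElement_mul_of_mem_specht hx (e ⟨u, hu⟩).2
      rw [map_smul, ← algebraMap_smul (MonoidAlgebra ℂ (Equiv.Perm (Fin n)))
        (2 * x * (n + 1 - x) : ℂ) (⟨u, hu⟩ : m), map_smul, algebraMap_smul]
      exact Subtype.ext h2
    exact congrArg Subtype.val h1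
  have h3 : exchangeElement n • (permRep n).asModuleEquiv.symm v =
    (2 * x * (n + 1 - x) : ℂ) • (permRep n).asModuleEquiv.symm v := hle (mem_isotypic.mp hv)
  rw [← asAlgebraHom_exchangeElement]
  exact h3

/-- A nonzero invariant complement would contain a vector with nonzero image under some Young
symmetrizer; that image lies in the complement and in an isotypic component. -/
theorem iSup_isotypicComponent_eq_top :
    ⨆ x : Fin (n / 2 + 1), isotypicComponent (MonoidAlgebra ℂ (Equiv.Perm (Fin n)))
      (permRep n).asModule (specht n x) = ⊤ := by
  obtain ⟨U, hU⟩ := exists_isCompl (⨆ x : Fin (n / 2 + 1), isotypicComponent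
    (MonoidAlgebra ℂ (Equiv.Perm (Fin n))) (permRep n).asModule (specht n x))
  by_cases hbot : U = ⊥
  · rw [← hU.sup_eq_top, hbot, sup_bot_eq]
  exfalso
  obtain ⟨u, hu, hu0⟩ := Submodule.exists_mem_ne_zero_of_ne_bot hbot
  obtain ⟨x, hx, w, hw, hw0, hanti, hsym⟩ := exists_antisymmetric_of_ne_bot
    (V := (U.restrictScalars ℂ).map (permRep n).asModuleEquiv.toLinearMap)
    (fun h => hu0 (by
      have : (permRep n).asModuleEquiv u ∈
        (U.restrictScalars ℂ).map (permRep n).asModuleEquiv.toLinearMap := ⟨u, hu, rfl⟩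
      rw [h, Submodule.mem_bot] at this
      simpa using this))
    (by
      rintro g _ ⟨a, ha, rfl⟩
      exact ⟨MonoidAlgebra.of ℂ _ g • a, U.smul_mem _ ha, by
        simp only [LinearEquiv.coe_coe, Representation.asModuleEquiv_map_smul,
          Representation.asAlgebraHom_of]⟩)
  obtain ⟨a, ha, rfl⟩ := hw
  have hne := youngSymmetrizer_apply_ne_zero hx hw0 hanti hsym
  have hc : youngSymmetrizer n x ≠ 0 := fun h => hne (by rw [h, map_zero]; rfl)
  have := isSimpleModule_specht hx hc
  have h1 : youngSymmetrizer n x • a ∈ isotypicComponent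
      (MonoidAlgebra ℂ (Equiv.Perm (Fin n))) (permRep n).asModule (specht n x) :=
    Submodule.map_le_isotypicComponent (specht n x) (LinearMap.toSpanSingleton _ _ a)
      ⟨_, Submodule.mem_span_singleton_self _, rfl⟩
  have h2 := Submodule.mem_iSup_of_mem (p := fun x : Fin (n / 2 + 1) =>
    isotypicComponent (MonoidAlgebra ℂ (Equiv.Perm (Fin n))) (permRep n).asModule (specht n x))
    ⟨x, by omega⟩ h1
  exact hne (Submodule.disjoint_def.mp hU.disjoint _ h2 (U.smul_mem _ ha))

theorem iSup_isotypic_eq_top : ⨆ x : Fin (n / 2 + 1), isotypic n x = ⊤ := by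
  rw [eq_top_iff]
  intro v _
  have hv : (permRep n).asModuleEquiv.symm v ∈ ⨆ x : Fin (n / 2 + 1), isotypicComponent
      (MonoidAlgebra ℂ (Equiv.Perm (Fin n))) (permRep n).asModule (specht n x) := by
    rw [iSup_isotypicComponent_eq_top]; trivial
  suffices h : ∀ u ∈ ⨆ x : Fin (n / 2 + 1), isotypicComponent
      (MonoidAlgebra ℂ (Equiv.Perm (Fin n))) (permRep n).asModule (specht n x),
      (permRep n).asModuleEquiv u ∈ ⨆ x : Fin (n / 2 + 1), isotypic n x by
    simpa using h _ hv
  intro u hu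
  induction hu using Submodule.iSup_induction' with
  | mem x u hu => exact Submodule.mem_iSup_of_mem x (mem_isotypic.mpr (by simpa using hu))
  | zero => simp
  | add u v _ _ hu hv => rw [map_add]; exact add_mem hu hv

theorem orthogonalFamily_isotypic :
    OrthogonalFamily ℂ (fun x : Fin (n / 2 + 1) => isotypic n x)
      fun x => (isotypic n x).subtypeₗᵢ := by
  intro x y hxy v w
  have hx : 2 * (x : ℕ) ≤ n := by omega
  have hy : 2 * (y : ℕ) ≤ n := by omega
  refine exchange_isSymmetric.orthogonalFamily_eigenspaces
    (i := (2 * x * (n + 1 - x) : ℂ)) (j := (2 * y * (n + 1 - y) : ℂ)) ?_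
    ⟨v, Module.End.mem_eigenspace_iff.mpr (exchange_apply_of_mem_isotypic hx v.2)⟩
    ⟨w, Module.End.mem_eigenspace_iff.mpr (exchange_apply_of_mem_isotypic hy w.2)⟩
  intro h
  -- Equal eigenvalues force `x = y` or `x + y = n + 1`, and the latter is impossible for `x, y ≤
  -- n/2`.
  have h1 : ((x : ℂ) - y) * (n + 1 - x - y) = 0 := by linear_combination h / 2
  rcases mul_eq_zero.mp h1 with h2 | h2
  · exact hxy (Fin.ext (by exact_mod_cast sub_eq_zero.mp h2))
  · have : (n : ℂ) + 1 = x + y := by linear_combination h2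
    norm_cast at this
    omega

theorem sum_starProjection_isotypic (ψ : Qubits n) :
    ∑ x : Fin (n / 2 + 1), (isotypic n x).starProjection ψ = ψ :=
  orthogonalFamily_isotypic.sum_projection_of_mem_iSup ψ (by rw [iSup_isotypic_eq_top]; trivial)

/-- The moments of the isotypic distribution in terms of the exchange operator. -/
theorem inner_exchange_pow (r : ℕ) (ψ : Qubits n) :
    (inner ℂ ψ ((exchange n ^ r) ψ)).re = ∑ x ∈ Finset.range (n / 2 + 1),
      (inner ℂ ψ ((isotypic n x).starProjection ψ)).re * (2 * x * (n + 1 - x) : ℝ) ^ r := by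
  have h1 : ∀ x : Fin (n / 2 + 1), (exchange n ^ r) ((isotypic n x).starProjection ψ) =
      (((2 * (x : ℕ) * (n + 1 - (x : ℕ)) : ℝ) ^ r : ℝ) : ℂ) • (isotypic n x).starProjection ψ := by
    intro x
    have hx : 2 * (x : ℕ) ≤ n := by omega
    induction r with
    | zero => simp
    | succ r ih =>
      rw [pow_succ', Module.End.mul_apply, ih, map_smul, exchange_apply_of_mem_isotypic hx
        (Submodule.starProjection_apply_mem _ _), smul_smul]
      push_cast
      ring_nf
  conv_lhs => rw [← sum_starProjection_isotypic ψ]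
  rw [map_sum, Finset.sum_congr rfl fun x _ => h1 x, sum_starProjection_isotypic, inner_sum,
    Complex.re_sum, Finset.sum_range]
  refine Finset.sum_congr rfl fun x _ => ?_
  rw [inner_smul_right, Complex.re_ofReal_mul, mul_comm]

theorem pmf_nonneg (n m k l x : ℕ) : 0 ≤ pmf n m k l x := by
  have h := Submodule.re_inner_starProjection_nonneg (isotypic n x) (Xi n m k l)
  rw [Submodule.inner_starProjection_left_eq_right] at h
  exact h

end Isotypic

/-! ### Reduction of the exchange operator to functions of `k` bits. -/

section LocalOperators

variable {k : ℕ}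

/-- The number of ones of a bit string. -/
def weight {n : ℕ} (s : Fin n → Fin 2) : ℕ := (Finset.univ.filter fun a => s a = 1).card

/-- The generator of the process that resamples each bit independently from the Bernoulli
distribution with parameter `ξ`. -/
def resampling (k : ℕ) (ξ : ℝ) : Module.End ℝ ((Fin k → Fin 2) → ℝ) where
  toFun f s := ∑ a, ((1 - ξ) * (f s - f (Function.update s a 0)) +
    ξ * (f s - f (Function.update s a 1)))
  map_add' f g := by
    ext s
    simp only [Pi.add_apply, ← Finset.sum_add_distrib]
    exact Finset.sum_congr rfl fun a _ => by ring
  map_smul' c f := by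
    ext s
    simp only [Pi.smul_apply, smul_eq_mul, Finset.mul_sum, RingHom.id_apply]
    exact Finset.sum_congr rfl fun a _ => by ring

/-- The correction to `resampling` of relative order `1 / n`. -/
def resamplingCorrection (k : ℕ) : Module.End ℝ ((Fin k → Fin 2) → ℝ) where
  toFun f s := (∑ a, ((weight s - k : ℝ) * (f s - f (Function.update s a 0)) -
      weight s * (f s - f (Function.update s a 1)))) +
    ∑ a, ∑ b, (f s - f (s ∘ Equiv.swap a b)) / 2
  map_add' f g := by
    ext s
    simp only [Pi.add_apply]
    refine Eq.trans (congrArg₂ (· + ·) ?_ ?_) (add_add_add_comm _ _ _ _)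
    · rw [← Finset.sum_add_distrib]
      exact Finset.sum_congr rfl fun a _ => by ring
    · rw [← Finset.sum_add_distrib]
      refine Finset.sum_congr rfl fun a _ => ?_
      rw [← Finset.sum_add_distrib]
      exact Finset.sum_congr rfl fun b _ => by ring
  map_smul' c f := by
    ext s
    simp only [Pi.smul_apply, smul_eq_mul, mul_add, Finset.mul_sum, RingHom.id_apply]
    congr 1
    · exact Finset.sum_congr rfl fun a _ => by ring
    · exact Finset.sum_congr rfl fun a _ => Finset.sum_congr rfl fun b _ => by ring

/-- The vector of weight `m` whose coordinates depend only on the first `k` bits, through `f`. -/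
def extend (N m : ℕ) (f : (Fin k → Fin 2) → ℝ) : Qubits (k + N) :=
  WithLp.toLp 2 fun j => if weight j = m then (f (j ∘ Fin.castAdd N) : ℂ) else 0

theorem extend_apply (N m : ℕ) (f : (Fin k → Fin 2) → ℝ) (j : Fin (k + N) → Fin 2) :
    extend N m f j = if weight j = m then (f (j ∘ Fin.castAdd N) : ℂ) else 0 := rfl

theorem weight_comp_perm {n : ℕ} (s : Fin n → Fin 2) (g : Equiv.Perm (Fin n)) :
    weight (s ∘ g) = weight s :=
  Finset.card_bij' (fun i _ => g i) (fun i _ => g⁻¹ i) (by simp) (by simp) (by simp) (by simp)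

theorem weight_add {N : ℕ} (j : Fin (k + N) → Fin 2) :
    weight j = weight (j ∘ Fin.castAdd N) + weight (j ∘ Fin.natAdd k) := by
  simp only [weight, Finset.card_filter, Fin.sum_univ_add, Function.comp_apply]

theorem sum_comp_eq_weight {N : ℕ} (t : Fin N → Fin 2) (h : Fin 2 → ℝ) :
    ∑ b, h (t b) = weight t * h 1 + (N - weight t) * h 0 := by
  have h1 : ∀ b, h (t b) = (if t b = 1 then 1 else 0) * (h 1 - h 0) + h 0 := fun b => by
    split_ifs with hb
    · rw [hb]; ring
    · have : t b = 0 := by omega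
      rw [this]; ring
  rw [Finset.sum_congr rfl fun b _ => h1 b, Finset.sum_add_distrib, ← Finset.sum_mul,
    Finset.sum_boole, Finset.sum_const, Finset.card_univ, Fintype.card_fin, nsmul_eq_mul, weight]
  ring

/-- Swaps beyond the first `k` positions do nothing, those inside them give a term of lower order,
and a swap of `a` with an outer position overwrites bit `a` by the outer bit. -/
theorem exchange_extend {N m : ℕ} {ξ : ℝ} (hn : 0 < k + N) (hm : (m : ℝ) = ξ * (k + N : ℕ))
    (f : (Fin k → Fin 2) → ℝ) : exchange (k + N) (extend N m f) =
      ((2 * (k + N : ℕ) : ℝ) : ℂ) • extend N m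
        ((resampling k ξ + ((k + N : ℕ) : ℝ)⁻¹ • resamplingCorrection k) f) := by
  ext j
  rw [exchange_apply, PiLp.smul_apply]
  simp only [extend_apply, weight_comp_perm]
  split_ifs with hw
  swap
  · simp
  set s := j ∘ Fin.castAdd N with hs
  set t := j ∘ Fin.natAdd k with ht
  have hcc : ∀ a b : Fin k, (j ∘ Equiv.swap (Fin.castAdd N a) (Fin.castAdd N b)) ∘ Fin.castAdd N =
      s ∘ Equiv.swap a b := fun a b => by
    ext c
    simp only [hs, Function.comp_apply, Equiv.swap_apply_def, Fin.castAdd_inj]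
    split_ifs <;> rfl
  have hcn : ∀ (a : Fin k) (b : Fin N),
      (j ∘ Equiv.swap (Fin.castAdd N a) (Fin.natAdd k b)) ∘ Fin.castAdd N =
      Function.update s a (t b) := fun a b => by
    funext c
    have : Fin.castAdd N c ≠ Fin.natAdd k b := fun h => by
      rw [Fin.ext_iff, Fin.val_castAdd, Fin.val_natAdd] at h; omega
    simp only [hs, ht, Function.comp_apply, Equiv.swap_apply_def, Fin.castAdd_inj, this, if_false,
      Function.update_apply]
    split_ifs <;> rfl
  have hnn : ∀ a b : Fin N,
      (j ∘ Equiv.swap (Fin.natAdd k a) (Fin.natAdd k b)) ∘ Fin.castAdd N = s := fun a b => by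
    funext c
    have : ∀ b, Fin.castAdd N c ≠ Fin.natAdd k b := fun b h => by
      rw [Fin.ext_iff, Fin.val_castAdd, Fin.val_natAdd] at h; omega
    simp only [hs, Function.comp_apply, Equiv.swap_apply_def, this, if_false]
  have hsum : ∑ a : Fin (k + N), ∑ b : Fin (k + N),
      (f s - f ((j ∘ Equiv.swap a b) ∘ Fin.castAdd N)) =
      ∑ a : Fin k, ∑ b : Fin k, (f s - f (s ∘ Equiv.swap a b)) +
        2 * ∑ a : Fin k, ∑ b : Fin N, (f s - f (Function.update s a (t b))) := by
    simp only [Fin.sum_univ_add, Finset.sum_add_distrib]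
    rw [Finset.sum_comm (s := (Finset.univ : Finset (Fin N))) (t := (Finset.univ : Finset (Fin k)))]
    simp only [fun (a : Fin N) (b : Fin k) => Equiv.swap_comm (Fin.natAdd k a) (Fin.castAdd N b),
      hcc, hcn, hnn, sub_self, Finset.sum_const_zero]
    ring
  have hwt : (weight t : ℝ) = m - weight s := by
    rw [← hw, weight_add]
    push_cast
    ring
  have hn' : ((k + N : ℕ) : ℝ) ≠ 0 := by positivity
  have key : ∑ a : Fin (k + N), ∑ b : Fin (k + N),
      (f s - f ((j ∘ Equiv.swap a b) ∘ Fin.castAdd N)) = 2 * (k + N : ℕ) *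
        (resampling k ξ + ((k + N : ℕ) : ℝ)⁻¹ • resamplingCorrection k) f s := by
    -- Only the number of outer ones, `m - weight s`, matters. With `m = ξ n` the counts of ones and
    -- zeros are `ξ n` and `(1 - ξ) n` up to terms free of `n`, which go into the correction.
    have hin : ∀ a : Fin k, ∑ b : Fin N, (f s - f (Function.update s a (t b))) =
        (m - weight s) * (f s - f (Function.update s a 1)) +
          (N - (m - weight s)) * (f s - f (Function.update s a 0)) := fun a => by
      rw [← hwt]
      exact sum_comp_eq_weight t fun b => f s - f (Function.update s a b)
    rw [hsum]
    simp only [hin]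
    simp only [LinearMap.add_apply, LinearMap.smul_apply, Pi.add_apply, Pi.smul_apply, smul_eq_mul,
      resampling, resamplingCorrection, LinearMap.coe_mk, AddHom.coe_mk, ← Finset.sum_div]
    have h2 : ∀ S P Q R : ℝ, P = (k + N : ℕ) * Q + R →
        S + 2 * P = 2 * (k + N : ℕ) * (Q + ((k + N : ℕ) : ℝ)⁻¹ * (R + S / 2)) := by
      intro S P Q R h
      rw [h]
      field_simp
      ring
    refine h2 _ _ _ _ ?_
    rw [Finset.mul_sum, ← Finset.sum_add_distrib]
    refine Finset.sum_congr rfl fun a _ => ?_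
    rw [hm]
    push_cast
    ring
  simp only [← Complex.ofReal_sub, ← Complex.ofReal_sum, smul_eq_mul, ← Complex.ofReal_mul]
  rw [key]

theorem exchange_pow_extend {N m : ℕ} {ξ : ℝ} (hn : 0 < k + N) (hm : (m : ℝ) = ξ * (k + N : ℕ))
    (f : (Fin k → Fin 2) → ℝ) (r : ℕ) : (exchange (k + N) ^ r) (extend N m f) =
      (((2 * (k + N : ℕ)) ^ r : ℝ) : ℂ) • extend N m
        (((resampling k ξ + ((k + N : ℕ) : ℝ)⁻¹ • resamplingCorrection k) ^ r) f) := by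
  induction r with
  | zero => simp
  | succ r ih =>
    rw [pow_succ', Module.End.mul_apply, ih, map_smul, exchange_extend hn hm, smul_smul,
      pow_succ' (_ + _), Module.End.mul_apply, ← Complex.ofReal_mul, ← pow_succ]

/-- The bit string `1^l 0^{k-l}`. -/
def blockString (k l : ℕ) : Fin k → Fin 2 := fun a => if (a : ℕ) < l then 1 else 0

theorem weight_blockString {l : ℕ} (hlk : l ≤ k) : weight (blockString k l) = l := by
  obtain ⟨q, rfl⟩ := Nat.exists_eq_add_of_le hlk
  rw [weight, Finset.card_filter, Fin.sum_univ_add]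
  simp [blockString]

theorem Xi_eq_smul_extend {N m l : ℕ} (hlk : l ≤ k) (hlm : l ≤ m) :
    Xi (k + N) m k l = (((Real.sqrt (N.choose (m - l)))⁻¹ : ℝ) : ℂ) •
      extend N m (Pi.single (blockString k l) 1) := by
  ext j
  rw [PiLp.smul_apply, extend_apply]
  simp only [Xi, Nat.add_sub_cancel_left]
  have h1 : (∀ i : Fin (k + N), (i : ℕ) < k → j i = if (i : ℕ) < l then 1 else 0) ↔
      j ∘ Fin.castAdd N = blockString k l := by
    constructor
    · intro h
      funext a
      exact h (Fin.castAdd N a) a.2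
    · intro h i hi
      exact congrFun h ⟨i, hi⟩
  have h2 : (Finset.univ.filter fun i : Fin (k + N) => k ≤ (i : ℕ) ∧ j i = 1).card =
      weight (j ∘ Fin.natAdd k) := by
    have l1 : ∀ i : Fin k, ¬ k ≤ (i : ℕ) := fun i => by omega
    simp only [weight, Finset.card_filter, Fin.sum_univ_add, Fin.val_castAdd, Fin.val_natAdd, l1]
    simp
  simp only [h1, h2]
  have h3 : j ∘ Fin.castAdd N = blockString k l → (weight (j ∘ Fin.natAdd k) = m - l ↔
      weight j = m) := fun h => by
    rw [weight_add, h, weight_blockString hlk]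
    omega
  by_cases ha : j ∘ Fin.castAdd N = blockString k l
  · simp [ha, h3 ha]
  · simp [ha]

theorem card_extensions {N m l : ℕ} (hlk : l ≤ k) (hlm : l ≤ m) :
    (Finset.univ.filter fun j : Fin (k + N) → Fin 2 =>
      weight j = m ∧ j ∘ Fin.castAdd N = blockString k l).card = N.choose (m - l) := by
  have h := Finset.card_powersetCard (m - l) (Finset.univ : Finset (Fin N))
  rw [Finset.card_univ, Fintype.card_fin] at h
  rw [← h]
  refine Finset.card_bij' (fun j _ => Finset.univ.filter fun b => j (Fin.natAdd k b) = 1)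
    (fun T _ => Fin.append (blockString k l) fun b => if b ∈ T then 1 else 0) ?_ ?_ ?_ ?_
  · intro j hj
    obtain ⟨h1, h2⟩ := (Finset.mem_filter.mp hj).2
    rw [Finset.mem_powersetCard]
    refine ⟨Finset.subset_univ _, ?_⟩
    rw [weight_add, h2, weight_blockString hlk] at h1
    exact (Nat.sub_eq_of_eq_add' h1.symm).symm
  · intro T hT
    have hT := (Finset.mem_powersetCard.mp hT).2
    have h2 : Fin.append (blockString k l) (fun b => if b ∈ T then (1 : Fin 2) else 0) ∘
        Fin.castAdd N = blockString k l := by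
      funext a; simp
    refine Finset.mem_filter.mpr ⟨Finset.mem_univ _, ?_, h2⟩
    rw [weight_add, h2, weight_blockString hlk]
    have h3 : weight (Fin.append (blockString k l) (fun b => if b ∈ T then (1 : Fin 2) else 0) ∘
        Fin.natAdd k) = T.card := by
      simp [weight]
    omega
  · intro j hj
    obtain ⟨h1, h2⟩ := (Finset.mem_filter.mp hj).2
    funext i
    refine Fin.addCases (fun a => ?_) (fun b => ?_) i
    · rw [Fin.append_left, ← h2, Function.comp_apply]
    · rw [Fin.append_right]
      simp only [Finset.mem_filter, Finset.mem_univ, true_and]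
      split_ifs with h
      · exact h.symm
      · omega
  · intro T hT
    ext b
    simp

theorem inner_Xi_extend {N m l : ℕ} (hlk : l ≤ k) (hlm : l ≤ m) (h : (Fin k → Fin 2) → ℝ) :
    inner ℂ (Xi (k + N) m k l) (extend N m h) =
      (((Real.sqrt (N.choose (m - l)))⁻¹ * N.choose (m - l) * h (blockString k l) : ℝ) : ℂ) := by
  have h1 : ∀ j : Fin (k + N) → Fin 2,
      inner ℂ (extend N m (Pi.single (blockString k l) 1) j) (extend N m h j) =
      if weight j = m ∧ j ∘ Fin.castAdd N = blockString k l then (h (blockString k l) : ℂ)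
        else 0 := by
    intro j
    simp only [extend_apply]
    by_cases ha : weight j = m
    · by_cases hb : j ∘ Fin.castAdd N = blockString k l
      · simp [ha, hb]
      · simp [ha, hb]
    · simp [ha]
  rw [Xi_eq_smul_extend hlk hlm, inner_smul_left, PiLp.inner_apply,
    Finset.sum_congr rfl fun j _ => h1 j, ← Finset.sum_filter, Finset.sum_const,
    card_extensions hlk hlm, nsmul_eq_mul, Complex.conj_ofReal]
  push_cast
  ring

/-- The moments of the rescaled exchange eigenvalue under the isotypic distribution. -/
theorem sum_pmf_mul_pow {n m l : ℕ} {ξ : ℝ} (hn : 0 < n) (h : Admissible n m k l)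
    (hm : (m : ℝ) = ξ * n) (r : ℕ) :
    ∑ x ∈ Finset.range (n / 2 + 1), pmf n m k l x * ((x : ℝ) * (n + 1 - x) / n) ^ r =
      ((resampling k ξ + (n : ℝ)⁻¹ • resamplingCorrection k) ^ r)
        (Pi.single (blockString k l) 1) (blockString k l) := by
  obtain ⟨N, rfl⟩ := Nat.exists_eq_add_of_le h.k_le
  have hn' : ((k + N : ℕ) : ℝ) ≠ 0 := by positivity
  have hC : (0 : ℝ) < N.choose (m - l) := by
    have := h.add_le
    exact_mod_cast Nat.choose_pos (by omega)
  have h1 := inner_exchange_pow r (Xi (k + N) m k l)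
  nth_rewrite 2 [Xi_eq_smul_extend h.l_le_k h.l_le_m] at h1
  rw [map_smul, exchange_pow_extend hn hm, inner_smul_right, inner_smul_right,
    inner_Xi_extend h.l_le_k h.l_le_m, ← Complex.ofReal_mul, ← Complex.ofReal_mul,
    Complex.ofReal_re] at h1
  -- The normalization of `Xi` enters twice and cancels the number of strings that extend `1^l
  -- 0^{k-l}`.
  have h2 : (Real.sqrt (N.choose (m - l)))⁻¹ * (Real.sqrt (N.choose (m - l)))⁻¹ *
      (N.choose (m - l) : ℝ) = 1 := by
    rw [← mul_inv, Real.mul_self_sqrt hC.le, inv_mul_cancel₀ hC.ne']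
  refine mul_left_cancel₀ (pow_ne_zero r (mul_ne_zero two_ne_zero hn')) ?_
  rw [Finset.mul_sum]
  have h3 : ∀ x : ℕ, (2 * ((k + N : ℕ) : ℝ)) ^ r * (pmf (k + N) m k l x *
      ((x : ℝ) * ((k + N : ℕ) + 1 - x) / (k + N : ℕ)) ^ r) =
      (inner ℂ (Xi (k + N) m k l) ((isotypic (k + N) x).starProjection (Xi (k + N) m k l))).re *
        (2 * x * ((k + N : ℕ) + 1 - x) : ℝ) ^ r := fun x => by
    rw [mul_left_comm, ← mul_pow, pmf]
    congr 2
    field_simp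
  rw [Finset.sum_congr rfl fun x _ => h3 x, ← h1]
  linear_combination (2 * ((k + N : ℕ) : ℝ)) ^ r *
    ((resampling k ξ + ((k + N : ℕ) : ℝ)⁻¹ • resamplingCorrection k) ^ r)
        (Pi.single (blockString k l) 1) (blockString k l) * h2

/-- Powers of `A + t B` differ from powers of `A` by `O(t)`. -/
theorem exists_abs_pow_add_smul_sub_le {ι : Type*} (A B : Module.End ℝ (ι → ℝ)) (r : ℕ)
    (f : ι → ℝ) (s : ι) :
    ∃ C, ∀ t ∈ Set.Icc (0 : ℝ) 1, |((A + t • B) ^ r) f s - (A ^ r) f s| ≤ C * t := by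
  induction r generalizing f with
  | zero => exact ⟨0, fun t _ => by simp⟩
  | succ r ih =>
    obtain ⟨C₁, h₁⟩ := ih (A f)
    obtain ⟨C₂, h₂⟩ := ih (B f)
    refine ⟨C₁ + (|C₂| + |(A ^ r) (B f) s|), fun t ht => ?_⟩
    -- The factor applied first is split off, which is why the induction is over all `f`; the part
    -- with `B` already carries a factor `t`.
    have e : ((A + t • B) ^ (r + 1)) f s - (A ^ (r + 1)) f s =
        (((A + t • B) ^ r) (A f) s - (A ^ r) (A f) s) +
          t * ((((A + t • B) ^ r) (B f) s - (A ^ r) (B f) s) + (A ^ r) (B f) s) := by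
      rw [pow_succ, pow_succ, Module.End.mul_apply, Module.End.mul_apply, LinearMap.add_apply,
        LinearMap.smul_apply, map_add, map_smul, Pi.add_apply, Pi.smul_apply, smul_eq_mul]
      ring
    have h3 : |((A + t • B) ^ r) (B f) s - (A ^ r) (B f) s| ≤ |C₂| :=
      (h₂ t ht).trans ((mul_le_mul_of_nonneg_right (le_abs_self _) ht.1).trans
        (mul_le_of_le_one_right (abs_nonneg _) ht.2))
    rw [e, add_mul]
    refine (abs_add_le _ _).trans (add_le_add (h₁ t ht) ?_)
    rw [abs_mul, abs_of_nonneg ht.1, mul_comm]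
    exact mul_le_mul_of_nonneg_right ((abs_add_le _ _).trans (by gcongr)) ht.1

end LocalOperators

/-! ### The limit law through generating polynomials. -/

section LimitLaw

open Polynomial

/-- The linear functional on polynomials that maps `X ^ j` to `g j`. -/
def coeffSum (g : ℕ → ℝ) : ℝ[X] →ₗ[ℝ] ℝ := Polynomial.lsum fun j => g j • LinearMap.id

theorem coeffSum_C_mul_X_pow (g : ℕ → ℝ) (c : ℝ) (j : ℕ) : coeffSum g (C c * X ^ j) = c * g j := by
  rw [C_mul_X_pow_eq_monomial, coeffSum, Polynomial.lsum_apply, sum_monomial_index]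
  · simp [mul_comm]
  · simp

/-- The generating polynomial of the Bernoulli distribution. -/
def bernoulliPoly (p : ℝ) : ℝ[X] := C p * X + C (1 - p)

/-- Conditioning on one Bernoulli summand; this is the recursion behind the mean and the variance.
-/
theorem coeffSum_mul_bernoulliPoly (g : ℕ → ℝ) (p : ℝ) (Q : ℝ[X]) :
    coeffSum g (bernoulliPoly p * Q) =
      p * coeffSum (fun j => g (j + 1)) Q + (1 - p) * coeffSum g Q := by
  induction Q using Polynomial.induction_on' with
  | add P Q hP hQ => rw [mul_add, map_add, map_add, map_add, hP, hQ]; ring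
  | monomial j c =>
    have h : bernoulliPoly p * monomial j c =
        C (p * c) * X ^ (j + 1) + C ((1 - p) * c) * X ^ j := by
      rw [bernoulliPoly, ← C_mul_X_pow_eq_monomial, C_mul, C_mul]
      ring
    rw [h, map_add, coeffSum_C_mul_X_pow, coeffSum_C_mul_X_pow, ← C_mul_X_pow_eq_monomial,
      coeffSum_C_mul_X_pow, coeffSum_C_mul_X_pow]
    ring

theorem coeffSum_mul (g : ℕ → ℝ) (P Q : ℝ[X]) :
    coeffSum g (P * Q) = coeffSum (fun a => coeffSum (fun b => g (a + b)) Q) P := by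
  induction P using Polynomial.induction_on' with
  | add P P' hP hP' => rw [add_mul, map_add, map_add, hP, hP']
  | monomial i c =>
    rw [← C_mul_X_pow_eq_monomial, coeffSum_C_mul_X_pow]
    induction Q using Polynomial.induction_on' with
    | add Q Q' hQ hQ' => rw [mul_add, map_add, map_add, hQ, hQ', mul_add]
    | monomial j d =>
      have h : C c * X ^ i * monomial j d = C (c * d) * X ^ (i + j) := by
        rw [← C_mul_X_pow_eq_monomial, C_mul]
        ring
      rw [h, coeffSum_C_mul_X_pow, ← C_mul_X_pow_eq_monomial, coeffSum_C_mul_X_pow]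
      ring

theorem integral_binomial_eq_coeffSum (j : ℕ) (p : unitInterval) (g : ℕ → ℝ) :
    ∫ x, g x ∂binomial j p = coeffSum g (bernoulliPoly p ^ j) := by
  rw [integral_binomial, bernoulliPoly, add_pow, map_sum]
  refine Finset.sum_congr (by ext; simp) fun i _ => ?_
  have h : (C (p : ℝ) * X) ^ i * C (1 - (p : ℝ)) ^ (j - i) * (j.choose i : ℝ[X]) =
      C ((j.choose i : ℝ) * (p : ℝ) ^ i * (1 - p) ^ (j - i)) * X ^ i := by
    rw [mul_pow, C_mul, C_mul, C_pow, C_pow, ← Polynomial.C_eq_natCast]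
    ring
  rw [h, coeffSum_C_mul_X_pow, smul_eq_mul]

instance isProbabilityMeasure_limitLaw (ξ : unitInterval) (k l : ℕ) :
    IsProbabilityMeasure (limitLaw ξ k l) := by
  unfold limitLaw
  infer_instance

theorem ae_limitLaw_le (ξ : unitInterval) {k l : ℕ} (hlk : l ≤ k) :
    ∀ᵐ x ∂limitLaw ξ k l, x ≤ k := by
  have h : ∀ (j : ℕ) (p : unitInterval), ∀ᵐ x ∂binomial j p, x ≤ j := fun j p =>
    ae_le_of_hasLaw_binomial (X := id) HasLaw.id
  unfold limitLaw Measure.conv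
  rw [ae_map_iff (by fun_prop) (by measurability)]
  filter_upwards [Measure.quasiMeasurePreserving_fst.ae (h (k - l) ξ),
    Measure.quasiMeasurePreserving_snd.ae (h l (unitInterval.symm ξ))] with z h1 h2
  omega

theorem integrable_limitLaw (ξ : unitInterval) {k l : ℕ} (hlk : l ≤ k) (g : ℕ → ℝ) :
    Integrable g (limitLaw ξ k l) := by
  refine Integrable.of_bound (measurable_of_countable g).aestronglyMeasurable
    (∑ j ∈ Finset.range (k + 1), ‖g j‖) ?_
  filter_upwards [ae_limitLaw_le ξ hlk] with x hx
  exact Finset.single_le_sum (f := fun j => ‖g j‖) (fun _ _ => norm_nonneg _)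
    (Finset.mem_range.mpr (by omega))

theorem integral_limitLaw (ξ : unitInterval) {k l : ℕ} (hlk : l ≤ k) (g : ℕ → ℝ) :
    ∫ x, g x ∂limitLaw ξ k l =
      coeffSum g (bernoulliPoly ξ ^ (k - l) * bernoulliPoly (1 - ξ) ^ l) := by
  have h := integrable_limitLaw ξ hlk g
  unfold limitLaw at h ⊢
  rw [integral_conv h, coeffSum_mul, ← integral_binomial_eq_coeffSum]
  refine integral_congr_ae (Eventually.of_forall fun a => ?_)
  have := integral_binomial_eq_coeffSum l (unitInterval.symm ξ) fun b => g (a + b)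
  rw [unitInterval.coe_symm_eq] at this
  exact this

theorem coeffSum_moments (p : ℝ) (j : ℕ) {Q : ℝ[X]} {μ v : ℝ}
    (h : coeffSum (fun _ => 1) Q = 1 ∧ coeffSum (fun x => (x : ℝ)) Q = μ ∧
      coeffSum (fun x => (x : ℝ) ^ 2) Q = v + μ ^ 2) :
    coeffSum (fun _ => 1) (bernoulliPoly p ^ j * Q) = 1 ∧
      coeffSum (fun x => (x : ℝ)) (bernoulliPoly p ^ j * Q) = μ + j * p ∧
      coeffSum (fun x => (x : ℝ) ^ 2) (bernoulliPoly p ^ j * Q) =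
        v + j * (p * (1 - p)) + (μ + j * p) ^ 2 := by
  have hadd : ∀ f g : ℕ → ℝ, ∀ Q, coeffSum (fun x => f x + g x) Q =
      coeffSum f Q + coeffSum g Q := fun f g Q => by
    induction Q using Polynomial.induction_on' with
    | add P Q hP hQ => rw [map_add, map_add, map_add, hP, hQ]; ring
    | monomial j c => simp only [← C_mul_X_pow_eq_monomial, coeffSum_C_mul_X_pow, mul_add]
  have hmul : ∀ (f : ℕ → ℝ) (a : ℝ) Q, coeffSum (fun x => a * f x) Q =
      a * coeffSum f Q := fun f a Q => by
    induction Q using Polynomial.induction_on' with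
    | add P Q hP hQ => rw [map_add, map_add, hP, hQ]; ring
    | monomial j c => simp only [← C_mul_X_pow_eq_monomial, coeffSum_C_mul_X_pow]; ring
  induction j with
  | zero => simpa using h
  | succ j ih =>
    obtain ⟨h0, h1, h2⟩ := ih
    have e : (fun x : ℕ => ((x + 1 : ℕ) : ℝ) ^ 2) =
        fun x : ℕ => ((x : ℝ) ^ 2 + 2 * (x : ℝ)) + 1 := by
      funext x
      push_cast
      ring
    simp only [pow_succ' (bernoulliPoly p), mul_assoc, coeffSum_mul_bernoulliPoly]
    refine ⟨by rw [h0]; ring, ?_, ?_⟩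
    · simp only [Nat.cast_add, Nat.cast_one]
      rw [hadd, h0, h1]
      ring
    · rw [e, hadd, hadd, hmul, h0, h1, h2]
      push_cast
      ring

theorem integral_id_limitLaw (ξ : unitInterval) {k l : ℕ} (hlk : l ≤ k) :
    ∫ x : ℕ, (x : ℝ) ∂limitLaw ξ k l = ((k : ℝ) - l) * ξ + l * (1 - ξ) ∧
    ∫ x : ℕ, (x : ℝ) ^ 2 ∂limitLaw ξ k l =
      k * ξ * (1 - ξ) + (((k : ℝ) - l) * ξ + l * (1 - ξ)) ^ 2 := by
  have h1 := coeffSum_moments (1 - ξ : ℝ) l (Q := 1) (μ := 0) (v := 0)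
    (by rw [← C_1, ← mul_one (C 1), ← pow_zero X]; simp only [coeffSum_C_mul_X_pow]; simp)
  rw [mul_one] at h1
  obtain ⟨-, h2, h3⟩ := coeffSum_moments (ξ : ℝ) (k - l) h1
  rw [integral_limitLaw ξ hlk, integral_limitLaw ξ hlk, h2, h3, Nat.cast_sub hlk]
  constructor <;> ring

theorem variance_limitLaw (ξ : unitInterval) {k l : ℕ} (hlk : l ≤ k) :
    variance (fun x : ℕ => (x : ℝ)) (limitLaw ξ k l) = k * (ξ : ℝ) * (1 - ξ) := by
  obtain ⟨h1, h2⟩ := integral_id_limitLaw ξ hlk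
  rw [variance_eq_sub]
  · simp only [Pi.pow_apply]
    rw [h1, h2]
    ring
  · rw [memLp_two_iff_integrable_sq (measurable_of_countable _).aestronglyMeasurable]
    exact integrable_limitLaw ξ hlk _

end LimitLaw

/-! ### Diagonalization of the resampling operator. -/

section Spectrum

open Polynomial

variable {k : ℕ}

/-- The probability of the bit `b` under the Bernoulli distribution. -/
def bitProb (ξ : ℝ) (b : Fin 2) : ℝ := if b = 1 then ξ else 1 - ξ

/-- The eigenvector of `resampling` attached to a set of sites, in the expansion of the indicator
function of `s₀`. -/
def resamplingEigenvector (ξ : ℝ) (s₀ : Fin k → Fin 2) (T : Finset (Fin k)) :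
    (Fin k → Fin 2) → ℝ := fun s =>
  (∏ a ∈ T, ((if s a = s₀ a then 1 else 0) - bitProb ξ (s₀ a))) *
    ∏ a ∈ Finset.univ \ T, bitProb ξ (s₀ a)

/-- The point mass is a product over sites. At each site the indicator splits into its mean and a
centred part, and `T` records where the centred part is chosen. -/
theorem single_eq_sum_resamplingEigenvector (ξ : ℝ) (s₀ : Fin k → Fin 2) :
    Pi.single s₀ 1 = ∑ T ∈ Finset.univ.powerset, resamplingEigenvector ξ s₀ T := by
  ext s
  simp only [Finset.sum_apply, resamplingEigenvector]
  rw [← Finset.prod_add, Pi.single_apply]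
  simp only [sub_add_cancel, Finset.prod_boole, Finset.mem_univ, true_imp_iff, funext_iff]

/-- The one-site operator is identity minus averaging: it fixes centred functions and kills
constants. -/
theorem resampling_resamplingEigenvector (ξ : ℝ) (s₀ : Fin k → Fin 2) (T : Finset (Fin k)) :
    resampling k ξ (resamplingEigenvector ξ s₀ T) =
      (T.card : ℝ) • resamplingEigenvector ξ s₀ T := by
  ext s
  simp only [resampling, LinearMap.coe_mk, AddHom.coe_mk, Pi.smul_apply, smul_eq_mul]
  have h : ∀ a, ((1 - ξ) * (resamplingEigenvector ξ s₀ T s -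
        resamplingEigenvector ξ s₀ T (Function.update s a 0)) +
      ξ * (resamplingEigenvector ξ s₀ T s -
        resamplingEigenvector ξ s₀ T (Function.update s a 1))) =
      if a ∈ T then resamplingEigenvector ξ s₀ T s else 0 := by
    intro a
    split_ifs with ha
    · have hu : ∀ b, resamplingEigenvector ξ s₀ T (Function.update s a b) =
          ((if b = s₀ a then 1 else 0) - bitProb ξ (s₀ a)) *
            ((∏ c ∈ T.erase a, ((if s c = s₀ c then 1 else 0) - bitProb ξ (s₀ c))) *
              ∏ a ∈ Finset.univ \ T, bitProb ξ (s₀ a)) := by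
        intro b
        rw [resamplingEigenvector, ← Finset.mul_prod_erase _ _ ha, Function.update_self, mul_assoc]
        congr 2
        refine Finset.prod_congr rfl fun c hc => ?_
        rw [Function.update_of_ne (Finset.ne_of_mem_erase hc)]
      rw [hu 0, hu 1]
      unfold bitProb
      rcases (by omega : s₀ a = 0 ∨ s₀ a = 1) with h0 | h0 <;> simp [h0] <;> ring
    · have hu : ∀ b, resamplingEigenvector ξ s₀ T (Function.update s a b) =
          resamplingEigenvector ξ s₀ T s := by
        intro b
        simp only [resamplingEigenvector]
        congr 1
        refine Finset.prod_congr rfl fun c hc => ?_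
        rw [Function.update_of_ne (fun h => ha (by rw [← h]; exact hc))]
      rw [hu, hu]
      ring
  rw [Finset.sum_congr rfl fun a _ => h a]
  simp

/-- At `s₀` the centred part at a site has value `1 - bitProb` and the constant part `bitProb`.
These are the weights of the eigenvalues 1 and 0, so the sum over `T` expands the generating
polynomial. -/
theorem resampling_pow_single (ξ : ℝ) (s₀ : Fin k → Fin 2) (r : ℕ) :
    (resampling k ξ ^ r) (Pi.single s₀ 1) s₀ =
      coeffSum (fun x => (x : ℝ) ^ r) (∏ a, bernoulliPoly (1 - bitProb ξ (s₀ a))) := by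
  have h1 : ∀ T : Finset (Fin k), (resampling k ξ ^ r) (resamplingEigenvector ξ s₀ T) =
      (T.card : ℝ) ^ r • resamplingEigenvector ξ s₀ T := fun T => by
    induction r with
    | zero => simp
    | succ r ih =>
      rw [pow_succ', Module.End.mul_apply, ih, map_smul, resampling_resamplingEigenvector,
        smul_smul, ← pow_succ]
  rw [single_eq_sum_resamplingEigenvector ξ, map_sum, Finset.sum_apply]
  simp only [bernoulliPoly, h1]
  rw [Finset.prod_add, map_sum]
  refine Finset.sum_congr rfl fun T _ => ?_
  rw [Finset.prod_mul_distrib, Finset.prod_const, mul_right_comm, ← map_prod, ← map_prod, ← C_mul,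
    coeffSum_C_mul_X_pow]
  simp [resamplingEigenvector, mul_comm]

theorem resampling_pow_blockString (ξ : unitInterval) {l : ℕ} (hlk : l ≤ k) (r : ℕ) :
    (resampling k ξ ^ r) (Pi.single (blockString k l) 1) (blockString k l) =
      ∫ x : ℕ, (x : ℝ) ^ r ∂limitLaw ξ k l := by
  rw [resampling_pow_single, integral_limitLaw ξ hlk]
  congr 1
  obtain ⟨q, rfl⟩ := Nat.exists_eq_add_of_le hlk
  rw [Fin.prod_univ_add]
  simp [blockString, bitProb, mul_comm]

end Spectrum

/-! ### From moments at rate `1/n` to total variation and expectation. -/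

section Moments

open Polynomial

/-- The eigenvalue of the exchange operator on the component `(n - x, x)`, divided by `2 n`. -/
def rescaledEigenvalue (n x : ℕ) : ℝ := (x : ℝ) * (n + 1 - x) / n

theorem exists_abs_eval_sub_le (F : ℝ[X]) :
    ∃ C, 0 ≤ C ∧ ∀ t ∈ Set.Icc (0 : ℝ) 1, |F.eval t - F.eval 0| ≤ C * t := by
  obtain ⟨C, hC⟩ := isCompact_Icc.exists_bound_of_continuousOn (s := Set.Icc (0 : ℝ) 1)
    (f := fun t => F.divX.eval t) F.divX.continuous.continuousOn
  refine ⟨C, (norm_nonneg _).trans (hC 0 (by simp)), fun t ht => ?_⟩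
  have h : F.eval t - F.eval 0 = F.divX.eval t * t := by
    conv_lhs => rw [← F.divX_mul_X_add]
    simp
  rw [h, abs_mul, abs_of_nonneg ht.1]
  exact mul_le_mul_of_nonneg_right (hC t ht) ht.1

/-- The rescaled eigenvalue is `x + x(1 - x) t` at `t = 1/n`, a polynomial in `t` for each of the
finitely many `x ≤ k`. -/
theorem exists_abs_eval_rescaledEigenvalue_sub_le (Q : ℝ[X]) (k : ℕ) :
    ∃ C, 0 ≤ C ∧ ∀ n : ℕ, 0 < n → ∀ x ≤ k,
      |Q.eval (rescaledEigenvalue n x) - Q.eval (x : ℝ)| ≤ C / n := by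
  choose C hC0 hC using fun x : ℕ => exists_abs_eval_sub_le
    (Q.comp (Polynomial.C (x : ℝ) + Polynomial.C ((x : ℝ) * (1 - x)) * X))
  refine ⟨∑ x ∈ Finset.range (k + 1), C x, Finset.sum_nonneg fun x _ => hC0 x,
    fun n hn x hx => ?_⟩
  have hn' : (0 : ℝ) < n := by exact_mod_cast hn
  have h := hC x (n : ℝ)⁻¹ ⟨by positivity, inv_le_one_of_one_le₀ (by exact_mod_cast hn)⟩
  have e : (x : ℝ) + x * (1 - x) * (n : ℝ)⁻¹ = rescaledEigenvalue n x := by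
    rw [rescaledEigenvalue]
    field_simp
    ring
  simp only [eval_comp, eval_add, eval_mul, eval_C, eval_X, mul_zero, add_zero, e] at h
  refine h.trans ?_
  rw [div_eq_mul_inv]
  refine mul_le_mul_of_nonneg_right ?_ (by positivity)
  exact Finset.single_le_sum (fun x _ => hC0 x) (Finset.mem_range.mpr (by omega))

theorem le_rescaledEigenvalue {n k x : ℕ} (hn : 0 < n) (hnk : 2 * k * (k + 1) ≤ n) (hkx : k < x)
    (hx : 2 * x ≤ n) : (k : ℝ) + 1 / 2 ≤ rescaledEigenvalue n x := by
  have hn' : (0 : ℝ) < n := by exact_mod_cast hn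
  rw [rescaledEigenvalue, le_div_iff₀ hn']
  have h1 : (2 * k * (k + 1) : ℝ) ≤ n := by exact_mod_cast hnk
  have h2 : (k + 1 : ℝ) ≤ x := by exact_mod_cast hkx
  have h3 : (2 * x : ℝ) ≤ n := by exact_mod_cast hx
  have h4 : (0 : ℝ) ≤ k := by positivity
  -- The product equals `x(n + 1 - x) - (k + 1)(n - k)`, and `(k + 1)(n - k)/n = k + 1 - k(k + 1)/n
  -- ≥ k + 1/2`.
  have h5 : (0 : ℝ) ≤ (x - (k + 1)) * (n - k - x) :=
    mul_nonneg (by linarith) (by nlinarith)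
  nlinarith

/-- A nonnegative polynomial that vanishes on `{0, …, k}` and is at least one beyond `k + 1/2`. -/
def tailPoly (k : ℕ) : ℝ[X] := ∏ j ∈ Finset.range (k + 1), C 4 * (X - C (j : ℝ)) ^ 2

theorem eval_tailPoly (k : ℕ) (y : ℝ) :
    (tailPoly k).eval y = ∏ j ∈ Finset.range (k + 1), 4 * (y - j) ^ 2 := by
  simp [tailPoly, eval_prod]

theorem eval_tailPoly_nonneg (k : ℕ) (y : ℝ) : 0 ≤ (tailPoly k).eval y := by
  rw [eval_tailPoly]
  exact Finset.prod_nonneg fun j _ => by positivity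

theorem eval_tailPoly_eq_zero {k x : ℕ} (hx : x ≤ k) : (tailPoly k).eval (x : ℝ) = 0 := by
  rw [eval_tailPoly]
  exact Finset.prod_eq_zero (Finset.mem_range.mpr (Nat.lt_succ_of_le hx)) (by simp)

theorem half_le_sub_of_mem_range {k j : ℕ} {y : ℝ} (hy : (k : ℝ) + 1 / 2 ≤ y)
    (hj : j ∈ Finset.range (k + 1)) : 1 / 2 ≤ y - j := by
  have : (j : ℝ) ≤ k := by exact_mod_cast Nat.lt_succ_iff.mp (Finset.mem_range.mp hj)
  linarith

theorem one_le_eval_tailPoly {k : ℕ} {y : ℝ} (hy : (k : ℝ) + 1 / 2 ≤ y) :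
    1 ≤ (tailPoly k).eval y := by
  rw [eval_tailPoly]
  refine Finset.one_le_prod fun j hj => ?_
  nlinarith [half_le_sub_of_mem_range hy hj]

/-- The Lagrange basis polynomial of `a` for the nodes `0, …, k`. -/
def lagrangePoly (k a : ℕ) : ℝ[X] :=
  ∏ j ∈ (Finset.range (k + 1)).erase a, C ((a : ℝ) - j)⁻¹ * (X - C (j : ℝ))

theorem eval_lagrangePoly (k a : ℕ) (y : ℝ) : (lagrangePoly k a).eval y =
    ∏ j ∈ (Finset.range (k + 1)).erase a, ((a : ℝ) - j)⁻¹ * (y - j) := by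
  simp [lagrangePoly, eval_prod]

theorem eval_lagrangePoly_natCast {k a x : ℕ} (hx : x ≤ k) :
    (lagrangePoly k a).eval (x : ℝ) = if x = a then 1 else 0 := by
  rw [eval_lagrangePoly]
  split_ifs with h
  · subst h
    refine Finset.prod_eq_one fun j hj => inv_mul_cancel₀ ?_
    rw [sub_ne_zero, Ne, Nat.cast_inj]
    exact (Finset.ne_of_mem_erase hj).symm
  · exact Finset.prod_eq_zero (Finset.mem_erase.mpr ⟨h, Finset.mem_range.mpr (by omega)⟩) (by simp)

/-- Factor by factor: distinct integers are at distance at least 1, and `u ≤ 4u²` for `u ≥ 1/2`. The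
extra factor of `tailPoly` is at least 1. -/
theorem abs_eval_lagrangePoly_le {k a : ℕ} {y : ℝ} (hy : (k : ℝ) + 1 / 2 ≤ y) :
    |(lagrangePoly k a).eval y| ≤ (tailPoly k).eval y := by
  rw [eval_lagrangePoly, eval_tailPoly, Finset.abs_prod]
  refine (Finset.prod_le_prod (fun j _ => abs_nonneg _) (g := fun j : ℕ => 4 * (y - j) ^ 2)
    fun j hj => ?_).trans (Finset.prod_le_prod_of_subset_of_one_le (Finset.erase_subset _ _) ?_ ?_)
  · have h1 := half_le_sub_of_mem_range hy (Finset.mem_of_mem_erase hj)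
    have h2 : (1 : ℝ) ≤ |(a : ℝ) - j| := by
      have h3 : (a : ℤ) - j ≠ 0 := by
        have := Finset.ne_of_mem_erase hj
        omega
      exact_mod_cast Int.one_le_abs h3
    rw [abs_mul, abs_inv, abs_of_nonneg (by linarith : 0 ≤ y - j)]
    have h4 : |(a : ℝ) - j|⁻¹ * (y - j) ≤ 1 * (y - j) :=
      mul_le_mul_of_nonneg_right (inv_le_one_of_one_le₀ h2) (by linarith)
    nlinarith
  · intro j _
    positivity
  · intro j hj _
    nlinarith [half_le_sub_of_mem_range hy hj]

variable {ι : Type*} {N : ι → ℕ} {p : ι → ℕ → ℝ} {μ : Measure ℕ} {k : ℕ}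

theorem exists_abs_sum_eval_sub_integral_le
    (hmom : ∀ r : ℕ, ∃ C, ∀ i, |∑ x ∈ Finset.range (N i / 2 + 1),
      p i x * rescaledEigenvalue (N i) x ^ r - ∫ x : ℕ, (x : ℝ) ^ r ∂μ| ≤ C / N i)
    (hint : ∀ g : ℕ → ℝ, Integrable g μ) (Q : ℝ[X]) :
    ∃ C, ∀ i, |∑ x ∈ Finset.range (N i / 2 + 1), p i x * Q.eval (rescaledEigenvalue (N i) x) -
      ∫ x : ℕ, Q.eval (x : ℝ) ∂μ| ≤ C / N i := by
  induction Q using Polynomial.induction_on' with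
  | add P Q hP hQ =>
    obtain ⟨C, hC⟩ := hP
    obtain ⟨D, hD⟩ := hQ
    refine ⟨C + D, fun i => ?_⟩
    simp only [eval_add, mul_add, Finset.sum_add_distrib]
    rw [integral_add (hint _) (hint _), add_sub_add_comm, add_div]
    exact (abs_add_le _ _).trans (add_le_add (hC i) (hD i))
  | monomial r c =>
    obtain ⟨C, hC⟩ := hmom r
    refine ⟨|c| * C, fun i => ?_⟩
    simp only [eval_monomial, mul_left_comm _ c]
    rw [← Finset.mul_sum, integral_const_mul, ← mul_sub, abs_mul, mul_div_assoc]
    exact mul_le_mul_of_nonneg_left (hC i) (abs_nonneg c)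

theorem exists_sum_tailPoly_le
    (hmom : ∀ r : ℕ, ∃ C, ∀ i, |∑ x ∈ Finset.range (N i / 2 + 1),
      p i x * rescaledEigenvalue (N i) x ^ r - ∫ x : ℕ, (x : ℝ) ^ r ∂μ| ≤ C / N i)
    (hint : ∀ g : ℕ → ℝ, Integrable g μ) (hμ : ∀ᵐ x ∂μ, x ≤ k) :
    ∃ C, 0 ≤ C ∧ ∀ i, ∑ x ∈ Finset.range (N i / 2 + 1),
      p i x * (tailPoly k).eval (rescaledEigenvalue (N i) x) ≤ C / N i := by
  obtain ⟨C, hC⟩ := exists_abs_sum_eval_sub_integral_le hmom hint (tailPoly k)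
  refine ⟨|C|, abs_nonneg C, fun i => ?_⟩
  have h0 : ∫ x : ℕ, (tailPoly k).eval (x : ℝ) ∂μ = 0 := by
    rw [integral_congr_ae (g := fun _ => (0 : ℝ))]
    · simp
    · filter_upwards [hμ] with x hx using eval_tailPoly_eq_zero hx
  have h1 := hC i
  rw [h0, sub_zero] at h1
  exact (le_abs_self _).trans (h1.trans (by gcongr; exact le_abs_self C))

/-- The Lagrange polynomial of `a` is the test function. It is within `O(1/n)` of the indicator of
`a` at the eigenvalues of `x ≤ k`; beyond, `tailPoly` dominates it, and the mean of `tailPoly` is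
`O(1/n)` because it vanishes on the support of `μ`. -/
theorem exists_abs_sub_measureReal_singleton_le (hN : ∀ i, 0 < N i) (hp : ∀ i x, 0 ≤ p i x)
    (hsum : ∀ i, ∑ x ∈ Finset.range (N i / 2 + 1), p i x = 1)
    (hmom : ∀ r : ℕ, ∃ C, ∀ i, |∑ x ∈ Finset.range (N i / 2 + 1),
      p i x * rescaledEigenvalue (N i) x ^ r - ∫ x : ℕ, (x : ℝ) ^ r ∂μ| ≤ C / N i)
    (hint : ∀ g : ℕ → ℝ, Integrable g μ) (hμ : ∀ᵐ x ∂μ, x ≤ k) {a : ℕ} (hak : a ≤ k) :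
    ∃ C, 0 ≤ C ∧ ∀ i, 2 * k * (k + 1) ≤ N i → a ∈ Finset.range (N i / 2 + 1) →
      |p i a - μ.real {a}| ≤ C / N i := by
  obtain ⟨C₁, hC₁, h₁⟩ := exists_abs_eval_rescaledEigenvalue_sub_le (lagrangePoly k a) k
  obtain ⟨C₂, hC₂, h₂⟩ := exists_sum_tailPoly_le hmom hint hμ
  obtain ⟨C₃, h₃⟩ := exists_abs_sum_eval_sub_integral_le hmom hint (lagrangePoly k a)
  refine ⟨C₁ + C₂ + |C₃|, by positivity, fun i hi ha => ?_⟩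
  have hL : ∫ x : ℕ, (lagrangePoly k a).eval (x : ℝ) ∂μ = μ.real {a} := by
    rw [← integral_indicator_one (measurableSet_singleton a)]
    refine integral_congr_ae ?_
    filter_upwards [hμ] with x hx
    rw [eval_lagrangePoly_natCast hx, Set.indicator_apply]
    rfl
  have hpa : p i a = ∑ x ∈ Finset.range (N i / 2 + 1), p i x * if x = a then 1 else 0 := by
    simp only [mul_ite, mul_one, mul_zero, Finset.sum_ite_eq', ha, if_true]
  have hterm : ∀ x ∈ Finset.range (N i / 2 + 1),
      |p i x * (if x = a then 1 else 0) -
        p i x * (lagrangePoly k a).eval (rescaledEigenvalue (N i) x)| ≤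
      p i x * (C₁ / N i) + p i x * (tailPoly k).eval (rescaledEigenvalue (N i) x) := by
    intro x hx
    rw [← mul_sub, abs_mul, abs_of_nonneg (hp i x), ← mul_add]
    refine mul_le_mul_of_nonneg_left ?_ (hp i x)
    rcases le_or_gt x k with hxk | hxk
    · rw [abs_sub_comm, ← eval_lagrangePoly_natCast hxk]
      exact (h₁ (N i) (hN i) x hxk).trans (le_add_of_nonneg_right (eval_tailPoly_nonneg _ _))
    · have hx2 : 2 * x ≤ N i := by
        have := Finset.mem_range.mp hx
        omega
      have hy := le_rescaledEigenvalue (hN i) hi hxk hx2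
      rw [if_neg (by omega), zero_sub, abs_neg]
      exact (abs_eval_lagrangePoly_le hy).trans (le_add_of_nonneg_left (by positivity))
  have h₄ : |p i a - ∑ x ∈ Finset.range (N i / 2 + 1),
      p i x * (lagrangePoly k a).eval (rescaledEigenvalue (N i) x)| ≤ C₁ / N i + C₂ / N i := by
    rw [hpa, ← Finset.sum_sub_distrib]
    refine (Finset.abs_sum_le_sum_abs _ _).trans ((Finset.sum_le_sum hterm).trans ?_)
    rw [Finset.sum_add_distrib, ← Finset.sum_mul, hsum, one_mul]
    exact add_le_add_right (h₂ i) _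
  have h₅ := h₃ i
  rw [hL] at h₅
  calc |p i a - μ.real {a}| ≤ C₁ / N i + C₂ / N i + C₃ / N i :=
        (abs_sub_le _ _ _).trans (add_le_add h₄ h₅)
    _ ≤ C₁ / N i + C₂ / N i + |C₃| / N i := by gcongr; exact le_abs_self C₃
    _ = (C₁ + C₂ + |C₃|) / N i := by ring

theorem exists_sum_tail_le (hN : ∀ i, 0 < N i) (hp : ∀ i x, 0 ≤ p i x)
    (hmom : ∀ r : ℕ, ∃ C, ∀ i, |∑ x ∈ Finset.range (N i / 2 + 1),
      p i x * rescaledEigenvalue (N i) x ^ r - ∫ x : ℕ, (x : ℝ) ^ r ∂μ| ≤ C / N i)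
    (hint : ∀ g : ℕ → ℝ, Integrable g μ) (hμ : ∀ᵐ x ∂μ, x ≤ k) :
    ∃ C, 0 ≤ C ∧ ∀ i, 2 * k * (k + 1) ≤ N i →
      ∑ x ∈ Finset.range (N i / 2 + 1) \ Finset.range (k + 1), p i x ≤ C / N i := by
  obtain ⟨C, hC, h⟩ := exists_sum_tailPoly_le hmom hint hμ
  refine ⟨C, hC, fun i hi => le_trans ?_ (h i)⟩
  refine (Finset.sum_le_sum fun x hx => ?_).trans (Finset.sum_le_sum_of_subset_of_nonneg
    Finset.sdiff_subset fun x _ _ => mul_nonneg (hp i x) (eval_tailPoly_nonneg _ _))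
  rw [Finset.mem_sdiff, Finset.mem_range, Finset.mem_range] at hx
  exact le_mul_of_one_le_right (hp i x) (one_le_eval_tailPoly
    (le_rescaledEigenvalue (hN i) hi (by omega) (by omega)))

theorem measureReal_eq_sum_of_ae_le [IsFiniteMeasure μ] (hμ : ∀ᵐ x ∂μ, x ≤ k) (A : Set ℕ) :
    μ.real A = ∑ a ∈ Finset.range (k + 1), A.indicator (fun a => μ.real {a}) a := by
  classical
  have h : μ.real A = μ.real ((Finset.range (k + 1)).filter (· ∈ A) : Finset ℕ) := by
    refine measureReal_congr ?_
    filter_upwards [hμ] with x hx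
    simp only [eq_iff_iff]
    change x ∈ A ↔ x ∈ (((Finset.range (k + 1)).filter (· ∈ A) : Finset ℕ) : Set ℕ)
    simp [hx]
  rw [h, ← sum_measureReal_singleton, Finset.sum_filter]
  simp [Set.indicator_apply]

/-- Convergence of the moments of the rescaled eigenvalue at rate `1 / n` implies convergence in
total variation at rate `1 / n`. -/
theorem exists_abs_sum_indicator_sub_measureReal_le [IsProbabilityMeasure μ]
    (hN : ∀ i, 0 < N i) (hp : ∀ i x, 0 ≤ p i x)
    (hsum : ∀ i, ∑ x ∈ Finset.range (N i / 2 + 1), p i x = 1)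
    (hmom : ∀ r : ℕ, ∃ C, ∀ i, |∑ x ∈ Finset.range (N i / 2 + 1),
      p i x * rescaledEigenvalue (N i) x ^ r - ∫ x : ℕ, (x : ℝ) ^ r ∂μ| ≤ C / N i)
    (hint : ∀ g : ℕ → ℝ, Integrable g μ) (hμ : ∀ᵐ x ∂μ, x ≤ k) :
    ∃ C, ∀ i (A : Set ℕ), |∑ x ∈ Finset.range (N i / 2 + 1), A.indicator (p i) x - μ.real A| ≤
      C / N i := by
  have hpt : ∀ a : ℕ, ∃ C, 0 ≤ C ∧ (a ≤ k → ∀ i, 2 * k * (k + 1) ≤ N i →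
      a ∈ Finset.range (N i / 2 + 1) → |p i a - μ.real {a}| ≤ C / N i) := fun a => by
    by_cases ha : a ≤ k
    · obtain ⟨C, hC, h⟩ := exists_abs_sub_measureReal_singleton_le hN hp hsum hmom hint hμ ha
      exact ⟨C, hC, fun _ => h⟩
    · exact ⟨0, le_rfl, fun h => absurd h ha⟩
  choose C hC0 hC using hpt
  obtain ⟨D, hD0, hD⟩ := exists_sum_tail_le hN hp hmom hint hμ
  have hS : 0 ≤ ∑ a ∈ Finset.range (k + 1), C a := Finset.sum_nonneg fun a _ => hC0 a
  -- The last summand covers `N i < 2k(k + 1)`, where the trivial bound 1 is enough.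
  refine ⟨(∑ a ∈ Finset.range (k + 1), C a) + D + (2 * k * (k + 1) : ℕ), fun i A => ?_⟩
  have hNi : (0 : ℝ) < N i := by exact_mod_cast hN i
  by_cases hi : 2 * k * (k + 1) ≤ N i
  · have hk : k ≤ N i / 2 := by
      have : 2 * k * 1 ≤ 2 * k * (k + 1) := Nat.mul_le_mul_left _ (by omega)
      omega
    have hsub : Finset.range (k + 1) ⊆ Finset.range (N i / 2 + 1) :=
      Finset.range_subset_range.mpr (by omega)
    rw [measureReal_eq_sum_of_ae_le hμ, ← Finset.sum_sdiff hsub, add_sub_assoc,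
      ← Finset.sum_sub_distrib]
    have h1 : |∑ x ∈ Finset.range (N i / 2 + 1) \ Finset.range (k + 1), A.indicator (p i) x| ≤
        D / N i := by
      rw [abs_of_nonneg (Finset.sum_nonneg fun x _ => Set.indicator_nonneg (fun x _ => hp i x) x)]
      exact (Finset.sum_le_sum fun x _ => Set.indicator_le_self' (fun _ _ => hp i x) x).trans
        (hD i hi)
    have h2 : |∑ a ∈ Finset.range (k + 1),
        (A.indicator (p i) a - A.indicator (fun a => μ.real {a}) a)| ≤
        ∑ a ∈ Finset.range (k + 1), C a / N i := by
      refine (Finset.abs_sum_le_sum_abs _ _).trans (Finset.sum_le_sum fun a ha => ?_)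
      by_cases haA : a ∈ A
      · rw [Set.indicator_of_mem haA, Set.indicator_of_mem haA]
        exact hC a (Nat.lt_succ_iff.mp (Finset.mem_range.mp ha)) i hi (hsub ha)
      · rw [Set.indicator_of_notMem haA, Set.indicator_of_notMem haA, sub_zero, abs_zero]
        exact div_nonneg (hC0 a) hNi.le
    rw [← Finset.sum_div] at h2
    refine (abs_add_le _ _).trans ((add_le_add h1 h2).trans ?_)
    rw [← add_div]
    have : (0 : ℝ) ≤ (2 * k * (k + 1) : ℕ) := by positivity
    exact div_le_div_of_nonneg_right (by linarith) hNi.le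
  · have h1 : 0 ≤ ∑ x ∈ Finset.range (N i / 2 + 1), A.indicator (p i) x :=
      Finset.sum_nonneg fun x _ => Set.indicator_nonneg (fun x _ => hp i x) x
    have h2 : ∑ x ∈ Finset.range (N i / 2 + 1), A.indicator (p i) x ≤ 1 := by
      rw [← hsum i]
      exact Finset.sum_le_sum fun x _ => Set.indicator_le_self' (fun _ _ => hp i x) x
    have h3 : μ.real A ≤ 1 := measureReal_le_one
    have h4 : 0 ≤ μ.real A := measureReal_nonneg
    have h5 : (N i : ℝ) ≤ (2 * k * (k + 1) : ℕ) := by exact_mod_cast (not_le.mp hi).le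
    have h6 : |∑ x ∈ Finset.range (N i / 2 + 1), A.indicator (p i) x - μ.real A| ≤ 1 := by
      rw [abs_le]
      constructor <;> linarith
    refine h6.trans ((one_le_div hNi).mpr ?_)
    linarith

/-- The difference is `x(x - 1)/n`, and `2x ≤ n` makes `x` at most twice the rescaled eigenvalue. A
bounded second moment thus controls the error in the mean. -/
theorem abs_sub_rescaledEigenvalue_le {n x : ℕ} (hn : 0 < n) (hx : 2 * x ≤ n) :
    |(x : ℝ) - rescaledEigenvalue n x| ≤ rescaledEigenvalue n x ^ 2 * (4 / n) := by
  have hn' : (0 : ℝ) < n := by exact_mod_cast hn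
  have h3 : (2 * x : ℝ) ≤ n := by exact_mod_cast hx
  have hx0 : (0 : ℝ) ≤ x := by positivity
  have e : (x : ℝ) - rescaledEigenvalue n x = x * (x - 1) / n := by
    rw [rescaledEigenvalue]
    field_simp
    ring
  have h1 : (0 : ℝ) ≤ x * (x - 1) := by
    rcases Nat.eq_zero_or_pos x with h | h
    · simp [h]
    · have : (1 : ℝ) ≤ x := by exact_mod_cast h
      nlinarith
  have h2 : (x : ℝ) ≤ 2 * rescaledEigenvalue n x := by
    rw [rescaledEigenvalue, mul_div_assoc', le_div_iff₀ hn']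
    nlinarith
  rw [e, abs_of_nonneg (by positivity), mul_div_assoc']
  exact div_le_div_of_nonneg_right (by nlinarith) hn'.le

theorem exists_abs_sum_mul_sub_integral_le (hN : ∀ i, 0 < N i) (hp : ∀ i x, 0 ≤ p i x)
    (hmom : ∀ r : ℕ, ∃ C, ∀ i, |∑ x ∈ Finset.range (N i / 2 + 1),
      p i x * rescaledEigenvalue (N i) x ^ r - ∫ x : ℕ, (x : ℝ) ^ r ∂μ| ≤ C / N i) :
    ∃ C, ∀ i, |∑ x ∈ Finset.range (N i / 2 + 1), p i x * x - ∫ x : ℕ, (x : ℝ) ∂μ| ≤ C / N i := by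
  obtain ⟨C₁, h₁⟩ := hmom 1
  obtain ⟨C₂, h₂⟩ := hmom 2
  simp only [pow_one] at h₁
  refine ⟨(|C₂| + ∫ x : ℕ, (x : ℝ) ^ 2 ∂μ) * 4 + C₁, fun i => ?_⟩
  have hNi : (1 : ℝ) ≤ N i := by exact_mod_cast hN i
  have h3 : |∑ x ∈ Finset.range (N i / 2 + 1), p i x * x -
      ∑ x ∈ Finset.range (N i / 2 + 1), p i x * rescaledEigenvalue (N i) x| ≤
      (∑ x ∈ Finset.range (N i / 2 + 1), p i x * rescaledEigenvalue (N i) x ^ 2) * (4 / N i) := by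
    rw [← Finset.sum_sub_distrib, Finset.sum_mul]
    refine (Finset.abs_sum_le_sum_abs _ _).trans (Finset.sum_le_sum fun x hx => ?_)
    have := Finset.mem_range.mp hx
    rw [← mul_sub, abs_mul, abs_of_nonneg (hp i x), mul_assoc]
    exact mul_le_mul_of_nonneg_left (abs_sub_rescaledEigenvalue_le (hN i) (by omega)) (hp i x)
  have h4 : ∑ x ∈ Finset.range (N i / 2 + 1), p i x * rescaledEigenvalue (N i) x ^ 2 ≤
      |C₂| + ∫ x : ℕ, (x : ℝ) ^ 2 ∂μ := by
    have h5 := (le_abs_self _).trans (h₂ i)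
    have h6 : C₂ / N i ≤ |C₂| :=
      (div_le_div_of_nonneg_right (le_abs_self _) (by linarith)).trans
        (div_le_self (abs_nonneg _) hNi)
    linarith
  refine (abs_sub_le _ _ _).trans ((add_le_add (h3.trans
    (mul_le_mul_of_nonneg_right h4 (by positivity))) (h₁ i)).trans_eq ?_)
  ring

end Moments

/-! ### Application to the measures `law` and `limitLaw`. -/

section Law

variable {k l : ℕ}

theorem measureReal_law (n m k l : ℕ) (A : Set ℕ) : (law n m k l).real A =
    ∑ x ∈ Finset.range (n / 2 + 1), A.indicator (pmf n m k l) x := by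
  rw [law, measureReal_def, Measure.finsetSum_apply, ENNReal.toReal_sum]
  · refine Finset.sum_congr rfl fun x _ => ?_
    rw [Measure.smul_apply, Measure.dirac_apply, smul_eq_mul, ENNReal.toReal_mul,
      ENNReal.toReal_ofReal (pmf_nonneg n m k l x)]
    by_cases hx : x ∈ A <;> simp [hx]
  · intro x _
    exact (ENNReal.mul_lt_top ENNReal.ofReal_lt_top (measure_lt_top _ _)).ne

theorem integral_law (n m k l : ℕ) : ∫ x : ℕ, (x : ℝ) ∂law n m k l =
    ∑ x ∈ Finset.range (n / 2 + 1), pmf n m k l x * x := by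
  rw [law, integral_finsetSum_measure]
  · refine Finset.sum_congr rfl fun x _ => ?_
    rw [integral_smul_measure, integral_dirac, ENNReal.toReal_ofReal (pmf_nonneg n m k l x),
      smul_eq_mul]
  · exact fun x _ => (integrable_dirac (by simp)).smul_measure (by simp)

theorem sum_pmf_eq_one {n m : ℕ} {ξ : ℝ} (hn : 0 < n) (h : Admissible n m k l)
    (hm : (m : ℝ) = ξ * n) : ∑ x ∈ Finset.range (n / 2 + 1), pmf n m k l x = 1 := by
  simpa using sum_pmf_mul_pow hn h hm 0

/-- The admissible pairs `(n, m)` with `n > 0` and `m = ξ n`. -/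
def AdmissiblePair (ξ : ℝ) (k l : ℕ) : Type :=
  {q : ℕ × ℕ // 0 < q.1 ∧ Admissible q.1 q.2 k l ∧ (q.2 : ℝ) = ξ * q.1}

/-- The perturbation bound is used at `t = 1/n`; its constant involves only the operators on `k`
bits, hence is uniform over all admissible pairs. -/
theorem exists_abs_moment_sub_le (ξ : unitInterval) (hlk : l ≤ k) (r : ℕ) :
    ∃ C, ∀ q : AdmissiblePair ξ k l, |∑ x ∈ Finset.range (q.1.1 / 2 + 1),
      pmf q.1.1 q.1.2 k l x * rescaledEigenvalue q.1.1 x ^ r -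
        ∫ x : ℕ, (x : ℝ) ^ r ∂limitLaw ξ k l| ≤ C / q.1.1 := by
  obtain ⟨C, hC⟩ := exists_abs_pow_add_smul_sub_le (resampling k ξ) (resamplingCorrection k) r
    (Pi.single (blockString k l) 1) (blockString k l)
  refine ⟨C, fun ⟨⟨n, m⟩, hn, hadm, hm⟩ => ?_⟩
  have h1 := sum_pmf_mul_pow hn hadm hm r
  simp only [rescaledEigenvalue]
  rw [h1, ← resampling_pow_blockString ξ hlk, div_eq_mul_inv]
  exact hC _ ⟨by positivity, inv_le_one_of_one_le₀ (by exact_mod_cast hn)⟩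

end Law

end SchurWeyl

end

open SchurWeyl in
theorem theorem5p1 (k l : ℕ) (hlk : l ≤ k) (ξ : unitInterval) :
    -- approximation up to `O(1/n)`, as probability distributions
    (∃ C : ℝ, ∀ n m : ℕ, 0 < n → Admissible n m k l → (m : ℝ) = (ξ : ℝ) * n →
      ∀ A : Set ℕ, |(law n m k l).real A - (limitLaw ξ k l).real A| ≤ C / n) ∧
    -- the limit is a probability distribution on `{0, …, k}`
    IsProbabilityMeasure (limitLaw ξ k l) ∧
    limitLaw ξ k l (Set.Iic k)ᶜ = 0 ∧
    -- expectation and variance of the limit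
    ∫ x : ℕ, (x : ℝ) ∂(limitLaw ξ k l) = ((k : ℝ) - l) * ξ + l * (1 - ξ) ∧
    variance (fun x : ℕ => (x : ℝ)) (limitLaw ξ k l) = k * (ξ : ℝ) * (1 - ξ) ∧
    -- asymptotic expectation of `P_{n,m,k,l}`
    (∀ n m : ℕ → ℕ, Tendsto n atTop atTop →
      (∀ j, Admissible (n j) (m j) k l ∧ (m j : ℝ) = (ξ : ℝ) * n j) →
      Tendsto (fun j => ∫ x : ℕ, (x : ℝ) ∂(law (n j) (m j) k l)) atTop
        (𝓝 (((k : ℝ) - l) * ξ + l * (1 - ξ)))) := by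
  refine ⟨?_, inferInstance, ae_limitLaw_le ξ hlk, (integral_id_limitLaw ξ hlk).1,
    variance_limitLaw ξ hlk, ?_⟩
  · obtain ⟨C, hC⟩ := exists_abs_sum_indicator_sub_measureReal_le
      (ι := AdmissiblePair ξ k l) (N := fun q => q.1.1) (p := fun q => pmf q.1.1 q.1.2 k l)
      (fun q => q.2.1) (fun q => pmf_nonneg _ _ _ _)
      (fun q => sum_pmf_eq_one q.2.1 q.2.2.1 q.2.2.2) (exists_abs_moment_sub_le ξ hlk)
      (integrable_limitLaw ξ hlk) (ae_limitLaw_le ξ hlk)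
    refine ⟨C, fun n m hn hadm hm A => ?_⟩
    rw [measureReal_law]
    exact hC ⟨(n, m), hn, hadm, hm⟩ A
  · intro n m hn h
    obtain ⟨C, hC⟩ := exists_abs_sum_mul_sub_integral_le
      (ι := AdmissiblePair ξ k l) (N := fun q => q.1.1) (p := fun q => pmf q.1.1 q.1.2 k l)
      (fun q => q.2.1) (fun q => pmf_nonneg _ _ _ _) (exists_abs_moment_sub_le ξ hlk)
    rw [← (integral_id_limitLaw ξ hlk).1, tendsto_iff_norm_sub_tendsto_zero]
    refine squeeze_zero' (Eventually.of_forall fun _ => norm_nonneg _) ?_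
      ((tendsto_const_nhds (x := C)).div_atTop (tendsto_natCast_atTop_atTop.comp hn))
    filter_upwards [hn.eventually_gt_atTop 0] with j hj
    rw [integral_law, Real.norm_eq_abs]
    exact hC ⟨(n j, m j), hj, (h j).1, (h j).2⟩
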